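/- Let $n_w, L, R, n_c, n_{\rm spl}$ be integers with $n_w, n_c, R \ge 1$, $L \ge 0$, $n_{\rm spl}\ge 2$ and $n_c \mid n_w$. Put $\mathcal V=\{1,\dots,n_w\}$ (words), $\mathcal C=\{1,\dots,n_c\}$ (concepts), $\mathcal X=\mathcal V^L$ (sentences), $\mathcal Z=\mathcal C^L$, and let $\Phi$ be the set of maps $\varphi:\mathcal V\to\mathcal C$ with $|\varphi^{-1}(\{c\})|=n_w/n_c$ for all $c\in\mathcal C$. For $\varphi\in\Phi$ and $\mathbf c\in\mathcal Z$, the sentence $\mathbf x$ is said to be generated by $\mathbf c$ if it is sampled uniformly from $\{\mathbf x\in\mathcal X:\varphi(x_i)=c_i \text{ for all } i\}$. Sample a task $(\varphi;\mathbf c_1,\dots,\mathbf c_R;\mathbf c_1',\dots,\mathbf c_R')$ uniformly from $\mathfrak T=\Phi\times\mathcal Z^{2R}$; then, independently given the task, sample training sentences $\mathbf x_{r,s}$ ($1\le r\le R$, $1\le s\le n_{\rm spl}$), where $\mathbf x_{r,1}$ is generated by $\mathbf c'_r$ (one unfamiliar sentence per category) and $\mathbf x_{r,s}$, $s\ge2$,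 is generated by $\mathbf c_r$, and a test sentence $\mathbf x^{\rm test}$ generated by $\mathbf c_1'$. For a real Hilbert space $\mathcal F$ and a map $\psi:\mathcal X\to\mathcal F$, let $$\overline{\rm err}(\mathcal F,\psi,\mathfrak T)=1-\mathbb P\Big[\exists s^*\ \forall r\ne1\ \forall s:\ \langle\psi(\mathbf x^{\rm test}),\psi(\mathbf x_{1,s^*})\rangle_{\mathcal F}>\langle\psi(\mathbf x^{\rm test}),\psi(\mathbf x_{r,s})\rangle_{\mathcal F}\Big]$$ be the expected error of the nearest-neighbor rule on unfamiliar test sentences (ties between categories count as failures). For $\mathbf k=(k_1,\dots,k_{L+1})\in\mathbb N^{L+1}$ let $\gamma(\mathbf k)=\sum_{i}(i-1)k_i$ and $\hat\gamma(\mathbf k)=\sum_i i\,k_i$, and for $0\le\ell\le L$ let $\mathcal S_\ell=\{\mathbf k\in\mathbb N^{L+1}:\hat\gamma(\mathbf k)=n_w,\ \ell\le\gamma(\mathbf k)\le L\}$. Let $\mathcal A_{\mathbf k}$ be the set of matrices $A\in\mathbb N^{(L+1)\times n_c}$ with $\sum_i iA_{ij}=n_w/n_c$ for all $j$ and $\sum_jA_{ij}=k_i$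 for all $i$. Define $$\mathfrak f(\mathbf k)=\big((n_w/n_c)!\big)^{n_c}\frac{n_c^L}{n_w!}\sum_{A\in\mathcal A_{\mathbf k}}\prod_{i=1}^{L+1}\frac{k_i!}{A_{i,1}!\cdots A_{i,n_c}!},$$ $$\mathfrak g(\mathbf k)=\frac{\gamma(\mathbf k)!}{n_w^{2L}}\left(\frac{n_w!}{k_1!\cdots k_{L+1}!}\prod_{i=2}^{L+1}\Big(\frac{i^{i-2}}{i!}\Big)^{k_i}\right)\left(\sum_{a=\gamma(\mathbf k)}^{L}\binom La\genfrac{\lbrace}{\rbrace}{0pt}{}{a}{\gamma(\mathbf k)}2^a n_w^{L-a}\right),$$ where $\genfrac{\lbrace}{\rbrace}{0pt}{}{a}{b}$ are the Stirling numbers of the second kind. Then for every real Hilbert space $\mathcal F$, every map $\psi:\mathcal X\to\mathcal F$ and every $0\le\ell\le L$, $$\overline{\rm err}(\mathcal F,\psi,\mathfrak T)\ \ge\ \sum_{\mathbf k\in\mathcal S_\ell}\mathfrak f(\mathbf k)\,\mathfrak g(\mathbf k)\;-\;\frac1R\Big(1+\frac12\max_{\mathbf k\in\mathcal S_\ell}\mathfrak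 f(\mathbf k)\Big),$$ where the maximum is read as $0$ if $\mathcal S_\ell$ is empty. -/

import Mathlib

noncomputable section

namespace ConceptModel

open Finset

/-! Throughout: `nw` words, `nc` concepts, sentences of length `L`, `R` categories,
`nspl` training sentences per category.  All index sets are `Fin _`, hence start at `0`. -/

/-- Sentences: sequences of `L` words. -/
abbrev Sentence (nw L : ℕ) : Type := Fin L → Fin nw

/-- Sequences of `L` concepts. -/
abbrev ConceptSeq (nc L : ℕ) : Type := Fin L → Fin nc

/-- Equipartitions of the vocabulary: maps from words to concepts such that every concept contains
`nw / nc` words (used only when `nc ∣ nw`). -/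
abbrev Equipartition (nw nc : ℕ) : Type :=
  {φ : Fin nw → Fin nc // ∀ c : Fin nc, #{w : Fin nw | φ w = c} = nw / nc}

/-- Tasks `(φ ; c₁, …, c_R ; c'₁, …, c'_R)`: an equipartition, `R` familiar sequences of concepts
and `R` unfamiliar ones. -/
abbrev Task (nw nc L R : ℕ) : Type :=
  Equipartition nw nc × (Fin R → ConceptSeq nc L) × (Fin R → ConceptSeq nc L)

/-- Training samples: `S r s` is the `s`-th training sentence of category `r`. -/
abbrev TrainSample (nw L R nspl : ℕ) : Type := Fin R → Fin nspl → Sentence nw L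

/-- The sequence of concepts underlying a sentence: `φ` applied word by word. -/
def conceptsOf {nw nc L : ℕ} (φ : Fin nw → Fin nc) (x : Sentence nw L) : ConceptSeq nc L :=
  fun i => φ (x i)

/-- Density, with respect to counting measure, of a sentence generated by the sequence of
concepts `c`, i.e. of the uniform distribution on the sentences `x` with `conceptsOf φ x = c`. -/
def sentenceDensity {nw nc L : ℕ} (φ : Fin nw → Fin nc) (c : ConceptSeq nc L)
    (x : Sentence nw L) : ℝ :=
  if conceptsOf φ x = c then 1 / (#{y : Sentence nw L | conceptsOf φ y = c} : ℝ) else 0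

/-- Density of the training sample of a task.  All sentences are independent; in each category the
first sentence (`s = 0`) is generated by the unfamiliar sequence of concepts `c' r`, the remaining
ones by the familiar sequence of concepts `c r`. -/
def trainDensity {nw nc L R nspl : ℕ} (T : Task nw nc L R) (S : TrainSample nw L R nspl) : ℝ :=
  ∏ r : Fin R, ∏ s : Fin nspl,
    sentenceDensity T.1.1 (if (s : ℕ) = 0 then T.2.2 r else T.2.1 r) (S r s)

/-- Joint density of (task, training sample, test sentence): the task is uniform among all tasks,
and, given the task, the training sample and the test sentence are independent, the test sentence
being generated by the unfamiliar sequence of concepts of the first category (`r = 0`). -/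
def jointDensity {nw nc L R nspl : ℕ} [NeZero R]
    (T : Task nw nc L R) (S : TrainSample nw L R nspl) (x : Sentence nw L) : ℝ :=
  1 / (Fintype.card (Task nw nc L R) : ℝ) * trainDensity T S * sentenceDensity T.1.1 (T.2.2 0) x

/-- The nearest-neighbor rule with feature map `ψ` succeeds on the test sentence `x`, which belongs
to the first category: some training sentence of the first category has a strictly larger inner
product with `x` (in feature space) than all training sentences of the other categories. -/
def NNSuccess {nw L R nspl : ℕ} [NeZero R] {F : Type*} [NormedAddCommGroup F]
    [InnerProductSpace ℝ F] (ψ : Sentence nw L → F) (S : TrainSample nw L R nspl)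
    (x : Sentence nw L) : Prop :=
  ∃ s₀ : Fin nspl, ∀ r : Fin R, r ≠ 0 → ∀ s : Fin nspl,
    inner ℝ (ψ x) (ψ (S r s)) < inner ℝ (ψ x) (ψ (S 0 s₀))

open Classical in
/-- Expected error of the nearest-neighbor rule with feature map `ψ` on unfamiliar test sentences,
over the collection of all tasks: one minus the probability of success. -/
def avgError (nc R nspl : ℕ) [NeZero R] {nw L : ℕ} {F : Type*} [NormedAddCommGroup F]
    [InnerProductSpace ℝ F] (ψ : Sentence nw L → F) : ℝ :=
  1 - ∑ T : Task nw nc L R, ∑ S : TrainSample nw L R nspl, ∑ x : Sentence nw L,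
    if NNSuccess ψ S x then jointDensity T S x else 0

/-- `γ(k) = ∑_{i=1}^{L+1} (i-1) k_i`; the entry `k_i` is `k ⟨i-1, _⟩`. -/
def gam {L : ℕ} (k : Fin (L + 1) → ℕ) : ℕ := ∑ i : Fin (L + 1), (i : ℕ) * k i

/-- `γ̂(k) = ∑_{i=1}^{L+1} i k_i`. -/
def gamHat {L : ℕ} (k : Fin (L + 1) → ℕ) : ℕ := ∑ i : Fin (L + 1), ((i : ℕ) + 1) * k i

/-- The set `S_ℓ` of all `k` with `γ̂(k) = nw` and `ℓ ≤ γ(k) ≤ L`.  The bound on the entries only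
serves to exhibit it as a finite set, see `mem_levelIndex`. -/
def levelIndex (nw L l : ℕ) : Finset (Fin (L + 1) → ℕ) :=
  {k ∈ Fintype.piFinset fun _ : Fin (L + 1) => Finset.range (nw + 1) |
    gamHat k = nw ∧ l ≤ gam k ∧ gam k ≤ L}

theorem mem_levelIndex {nw L l : ℕ} (k : Fin (L + 1) → ℕ) :
    k ∈ levelIndex nw L l ↔ gamHat k = nw ∧ l ≤ gam k ∧ gam k ≤ L := by
  simp only [levelIndex, Finset.mem_filter, Fintype.mem_piFinset, Finset.mem_range,
    and_iff_right_iff_imp]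
  rintro ⟨h, -⟩ i
  have h1 : ((i : ℕ) + 1) * k i ≤ gamHat k :=
    Finset.single_le_sum (f := fun i : Fin (L + 1) => ((i : ℕ) + 1) * k i)
      (fun _ _ => Nat.zero_le _) (Finset.mem_univ i)
  nlinarith [Nat.zero_le ((i : ℕ) * k i)]

/-- The set `A_k` of `k`-admissible matrices, i.e. of all `(L+1) × nc` matrices `A` of natural
numbers with `∑_i i A_{ij} = nw / nc` for all `j` and `∑_j A_{ij} = k_i` for all `i`.  The bound on
the entries only serves to exhibit it as a finite set, see `mem_admissible`. -/
def admissible (nw nc : ℕ) {L : ℕ} (k : Fin (L + 1) → ℕ) :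
    Finset (Fin (L + 1) → Fin nc → ℕ) :=
  {A ∈ Fintype.piFinset fun i : Fin (L + 1) =>
      Fintype.piFinset fun _ : Fin nc => Finset.range (k i + 1) |
    (∀ j : Fin nc, ∑ i : Fin (L + 1), ((i : ℕ) + 1) * A i j = nw / nc) ∧
      ∀ i : Fin (L + 1), ∑ j : Fin nc, A i j = k i}

theorem mem_admissible {nw nc L : ℕ} (k : Fin (L + 1) → ℕ) (A : Fin (L + 1) → Fin nc → ℕ) :
    A ∈ admissible nw nc k ↔
      (∀ j : Fin nc, ∑ i : Fin (L + 1), ((i : ℕ) + 1) * A i j = nw / nc) ∧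
        ∀ i : Fin (L + 1), ∑ j : Fin nc, A i j = k i := by
  simp only [admissible, Finset.mem_filter, Fintype.mem_piFinset, Finset.mem_range,
    and_iff_right_iff_imp]
  rintro ⟨-, h⟩ i j
  have h1 : A i j ≤ ∑ j : Fin nc, A i j :=
    Finset.single_le_sum (f := fun j : Fin nc => A i j)
      (fun _ _ => Nat.zero_le _) (Finset.mem_univ j)
  rw [h i] at h1
  omega

/-- `f(k) = ((nw/nc)!)^nc · nc^L / nw! · ∑_{A ∈ A_k} ∏_i k_i! / (A_{i,1}! ⋯ A_{i,nc}!)`. -/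
def fComb (nw nc : ℕ) {L : ℕ} (k : Fin (L + 1) → ℕ) : ℝ :=
  ((nw / nc).factorial : ℝ) ^ nc * ((nc : ℝ) ^ L / (nw.factorial : ℝ)) *
    ∑ A ∈ admissible nw nc k, ∏ i : Fin (L + 1),
      ((k i).factorial : ℝ) / ∏ j : Fin nc, ((A i j).factorial : ℝ)

/-- `g(k) = γ(k)! / nw^{2L} · (nw! / (k_1! ⋯ k_{L+1}!) · ∏_{i=2}^{L+1} (i^{i-2} / i!)^{k_i}) ·
∑_{a=γ(k)}^{L} (L choose a) {a over γ(k)} 2^a nw^{L-a}`, where `{a over b}` is a Stirling number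
of the second kind.  In the product, `i : Fin L` stands for the size `i + 2`. -/
def gComb (nw : ℕ) {L : ℕ} (k : Fin (L + 1) → ℕ) : ℝ :=
  ((gam k).factorial : ℝ) / (nw : ℝ) ^ (2 * L) *
    ((nw.factorial : ℝ) / (∏ i : Fin (L + 1), ((k i).factorial : ℝ)) *
      ∏ i : Fin L, (((i : ℝ) + 2) ^ (i : ℕ) / (((i : ℕ) + 2).factorial : ℝ)) ^ k i.succ) *
    ∑ a ∈ Finset.Icc (gam k) L,
      (L.choose a : ℝ) * (Nat.stirlingSecond a (gam k) : ℝ) * 2 ^ a * (nw : ℝ) ^ (L - a)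

/-- Maximum of a real function on a finite set, with the value `0` on the empty set. -/
def maxOverFinset {α : Type*} (s : Finset α) (f : α → ℝ) : ℝ :=
  if h : s.Nonempty then s.sup' h f else 0

end ConceptModel

end

open ConceptModel

/-!
Write `K x z = ⟪ψ x, ψ z⟫`. Let `x` be the test sentence and `y` the unfamiliar training sentence
of its category. If the rule succeeds, then either some familiar sentence of the first category
beats all familiar sentences of the other categories, or `y` beats the unfamiliar sentences of the
other categories and one familiar sentence of every category, its own included
(`familiarWins_or_unfamiliarWins`). The first event has probability at most `1 / R` by
exchangeability (`sum_familiarWins_le`). In the second event `y` has `2 * R - 1` competitors that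
are independent of `(x, y)` and uniform, so its probability is the expectation of
`rankFrac K x y ^ (2 * R - 1)`, where `rankFrac K x y` is the proportion of sentences with smaller
similarity to `x` (`sum_unfamiliarWins`).

The law of `(x, y)` is `pairMass`, which depends only on the graph on the words that joins `x i` to
`y i`. If this graph is a forest with `k i` components of size `i + 1`, the mass is
`fComb nw nc k / nw ^ (2 * L)`, because an equipartition identifies the two sequences of concepts
if and only if it is constant on the components (`pairMass_of_mem`, `card_colorings`). There are at
least `nw ^ (2 * L) * gComb nw k` such pairs (`gComb_le`): the forests are counted by means of
Cayley's lower bound for trees (`le_card_rootedForests`, `le_card_forestsOfType`), the pairs of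
sentences with a given forest by a recursion on `L` (`card_properEdges_eq`).

Bounding the rank by `1` on all other pairs and the mass by its maximum on the forest pairs gives
the theorem, as the powers of the ranks satisfy `∑ y, rank y ^ (2 * R - 1) ≤ N ^ (2 * R) / (2 * R)`
(`mul_sum_card_lt_pow_le`).
-/

namespace ConceptModel

open Finset

/-! ### Ranks, multinomial counts and coverings of an edge set -/

/-- Discrete form of `∫ x in 0..1, x ^ t = 1 / (t + 1)`: when the elements of `s` are compared
through `u`, the `t`-th powers of their ranks sum to at most `#s ^ (t + 1) / (t + 1)`, ties or
not. -/
theorem mul_sum_card_lt_pow_le {X : Type*} [DecidableEq X] (u : X → ℝ) (t : ℕ) (s : Finset X) :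
    (t + 1) * ∑ y ∈ s, #{z ∈ s | u z < u y} ^ t ≤ #s ^ (t + 1) := by
  induction s using Finset.induction_on_max_value u with
  | empty => simp
  | insert a s ha hmax ih =>
    -- An element `a` with maximal value leaves the ranks of the others unchanged and has rank at
    -- most `#s` itself.
    have h1 : ∀ y ∈ s, #{z ∈ insert a s | u z < u y} = #{z ∈ s | u z < u y} := by
      intro y hy
      rw [filter_insert, if_neg (not_lt.2 (hmax y hy))]
    have h2 : #{z ∈ insert a s | u z < u a} ≤ #s := by
      rw [filter_insert, if_neg (lt_irrefl _)]
      exact card_filter_le _ _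
    rw [sum_insert ha, sum_congr rfl fun y hy => by rw [h1 y hy], card_insert_of_notMem ha, mul_add]
    have h3 : (t + 1) * #s ^ t + #s ^ (t + 1) ≤ (#s + 1) ^ (t + 1) := by
      rw [add_pow, sum_range_succ, sum_range_succ]
      simp only [one_pow, mul_one, Nat.choose_self, Nat.choose_succ_self_right, Nat.cast_id]
      have := Nat.zero_le (∑ x ∈ range t, #s ^ x * (t + 1).choose x)
      linarith
    have h4 : (t + 1) * #{z ∈ insert a s | u z < u a} ^ t ≤ (t + 1) * #s ^ t := by gcongr
    omega

/-- Multinomial count of the functions with prescribed fiber sizes: permutations of the source act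
transitively on them, with stabilizers of order `∏ c, (a c)!`. -/
theorem card_fiber_functions {B C : Type*} [Fintype B] [DecidableEq B] [Fintype C] [DecidableEq C]
    (a : C → ℕ) (ha : ∑ c, a c = Fintype.card B) :
    #{f : B → C | ∀ c, #{b | f b = c} = a c} * ∏ c, (a c).factorial
      = (Fintype.card B).factorial := by
  classical
  obtain ⟨e⟩ : Nonempty (B ≃ Σ c, Fin (a c)) := ⟨Fintype.equivOfCardEq (by simp [ha])⟩
  let f₀ : B → C := fun b => (e b).1
  have hf₀ : ∀ c, #{b | f₀ b = c} = a c := by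
    intro c
    have : #{b | f₀ b = c} = #{q : Σ c, Fin (a c) | q.1 = c} :=
      card_equiv e fun b => by simp [f₀]
    rw [this]
    have h : ({q : Σ c, Fin (a c) | q.1 = c} : Finset _)
        = ({c} : Finset C).sigma (fun c => (univ : Finset (Fin (a c)))) := by
      ext q; simp
    rw [h, card_sigma]; simp
  have hperm : ∀ f ∈ ({f : B → C | ∀ c, #{b | f b = c} = a c} : Finset _),
      #{σ : Equiv.Perm B | f₀ ∘ σ = f} = ∏ c, (a c).factorial := by
    intro f hf
    simp only [mem_filter, mem_univ, true_and] at hf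
    have hc : ∀ c, Nonempty ({b // f b = c} ≃ {b // f₀ b = c}) := fun c =>
      ⟨Fintype.equivOfCardEq (by rw [Fintype.card_subtype, Fintype.card_subtype, hf, hf₀])⟩
    let g := fun c => (hc c).some
    let τ : Equiv.Perm B := (Equiv.sigmaFiberEquiv f).symm.trans
      ((Equiv.sigmaCongrRight g).trans (Equiv.sigmaFiberEquiv f₀))
    have hτ : ∀ b, f₀ (τ b) = f b := fun b => (g (f b) ⟨b, rfl⟩).2
    have h2 := DomMulAct.stabilizer_card f₀
    simp only [Fintype.card_subtype, hf₀] at h2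
    rw [← h2]
    refine card_equiv (Equiv.mulRight τ⁻¹) fun σ => ?_
    simp only [mem_filter, mem_univ, true_and, funext_iff, Function.comp, Equiv.coe_mulRight,
      Equiv.Perm.mul_apply]
    constructor
    · intro h b
      rw [h, ← hτ]; simp
    · intro h b
      rw [← hτ b, ← h (τ b)]; simp
  have hall := card_eq_sum_card_fiberwise (s := (univ : Finset (Equiv.Perm B)))
    (t := {f : B → C | ∀ c, #{b | f b = c} = a c}) (f := fun σ : Equiv.Perm B => f₀ ∘ σ) (by
      intro σ _
      simp only [coe_filter, mem_univ, true_and, Set.mem_ofPred_eq]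
      intro c
      rw [← hf₀ c]
      exact card_equiv σ fun b => by simp)
  rw [sum_congr rfl hperm, sum_const, smul_eq_mul, card_univ, Fintype.card_perm] at hall
  exact hall.symm

/-- The bijections `σ` with `f ∘ σ = g` are either none or a coset of the stabilizer of `f`. -/
theorem card_equiv_comp_le {A B C : Type*} [Fintype A] [DecidableEq A] [Fintype B] [DecidableEq B]
    [Fintype C] [DecidableEq C] (f : B → C) (g : A → C) :
    #{σ : A ≃ B | ∀ b, f (σ b) = g b} ≤ ∏ c, (#{b | f b = c}).factorial := by
  rcases Finset.eq_empty_or_nonempty ({σ : A ≃ B | ∀ b, f (σ b) = g b} : Finset _)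
    with h | ⟨σ₀, h₀⟩
  · simp [h]
  · have h2 := DomMulAct.stabilizer_card f
    simp only [Fintype.card_subtype] at h2
    rw [← h2]
    refine card_le_card_of_injOn (fun σ => σ₀.symm.trans σ) ?_ ?_
    · intro σ hσ
      simp only [coe_filter, mem_univ, true_and, Set.mem_ofPred_eq, mem_filter] at hσ h₀ ⊢
      funext b
      simp [hσ, ← h₀]
    · intro σ _ τ _ h
      ext b
      have := congrArg (fun q : Equiv.Perm B => q (σ₀ b)) h
      simpa using this

/-- The edges (loops discarded, multiplicities and orientations forgotten) of the multigraph that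
joins the two entries of each of the `L` pairs. -/
def properEdges {V : Type*} [DecidableEq V] {L : ℕ} (z : Fin L → V × V) : Finset (Sym2 V) :=
  {e ∈ univ.image fun i => s((z i).1, (z i).2) | ¬ e.IsDiag}

/-- The number of sequences of `L` ordered pairs of elements of an `n`-element set whose proper
edges form a given set of `g` edges, see `card_properEdges_eq`: `a` positions carry edges, which
are assigned surjectively and then oriented, the others carry loops. -/
def coverCount (n L g : ℕ) : ℕ :=
  g.factorial * ∑ a ∈ range (L + 1), L.choose a * Nat.stirlingSecond a g * 2 ^ a * n ^ (L - a)

theorem coverCount_zero (n g : ℕ) : coverCount n 0 g = if g = 0 then 1 else 0 := by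
  cases g <;> simp [coverCount]

/-- Recursion on the first pair: it is a loop (`n` choices) or an oriented edge (`2 * g` choices),
and in the latter case the remaining pairs either cover this edge again or do not. -/
theorem coverCount_succ (n L g : ℕ) :
    coverCount n (L + 1) g
      = n * coverCount n L g + 2 * g * (coverCount n L g + coverCount n L (g - 1)) := by
  -- Pascal's rule separates the terms; `S` stands for `Nat.stirlingSecond · g`.
  have key : ∀ S : ℕ → ℕ,
      ∑ a ∈ range (L + 2), (L + 1).choose a * S a * 2 ^ a * n ^ (L + 1 - a)
        = n * ∑ a ∈ range (L + 1), L.choose a * S a * 2 ^ a * n ^ (L - a)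
          + 2 * ∑ a ∈ range (L + 1), L.choose a * S (a + 1) * 2 ^ a * n ^ (L - a) := by
    intro S
    have h1 : n * ∑ a ∈ range (L + 1), L.choose a * S a * 2 ^ a * n ^ (L - a)
        = ∑ a ∈ range (L + 2), L.choose a * S a * 2 ^ a * n ^ (L + 1 - a) := by
      rw [sum_range_succ _ (L + 1), Nat.choose_succ_self, mul_sum]
      simp only [zero_mul, add_zero]
      refine sum_congr rfl fun a ha => ?_
      rw [mem_range] at ha
      rw [show L + 1 - a = (L - a) + 1 by omega, pow_succ]; ring
    rw [h1, sum_range_succ', sum_range_succ' _ (L + 1), mul_sum]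
    rw [add_right_comm, ← sum_add_distrib]
    simp only [Nat.choose_zero_right]
    congr 1
    refine sum_congr rfl fun a _ => ?_
    rw [Nat.choose_succ_succ, show L + 1 - (a + 1) = L - a by omega]; ring
  cases g with
  | zero =>
    simp only [coverCount, key]
    simp [Nat.stirlingSecond_succ_zero]
  | succ g =>
    simp only [coverCount, key, Nat.stirlingSecond_succ_succ, Nat.add_sub_cancel,
      Nat.factorial_succ]
    have : ∑ a ∈ range (L + 1), L.choose a * ((g + 1) * a.stirlingSecond (g + 1)
          + a.stirlingSecond g) * 2 ^ a * n ^ (L - a)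
        = (g + 1) * ∑ a ∈ range (L + 1), L.choose a * a.stirlingSecond (g + 1) * 2 ^ a * n ^ (L - a)
          + ∑ a ∈ range (L + 1), L.choose a * a.stirlingSecond g * 2 ^ a * n ^ (L - a) := by
      rw [mul_sum, ← sum_add_distrib]
      exact sum_congr rfl fun a _ => by ring
    rw [this]; ring

theorem properEdges_cons {V : Type*} [DecidableEq V] {L : ℕ} (q : V × V) (z : Fin L → V × V) :
    properEdges (Fin.cons q z : Fin (L + 1) → V × V)
      = if q.1 = q.2 then properEdges z else insert s(q.1, q.2) (properEdges z) := by
  ext e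
  split_ifs with h
  · simp only [properEdges, mem_filter, mem_image, mem_univ, true_and, Fin.exists_fin_succ,
      Fin.cons_zero, Fin.cons_succ]
    constructor
    · rintro ⟨h1 | h1, h2⟩
      · exact absurd (by rw [← h1, h]; simp) h2
      · exact ⟨h1, h2⟩
    · rintro ⟨h1, h2⟩
      exact ⟨Or.inr h1, h2⟩
  · simp only [properEdges, mem_filter, mem_image, mem_univ, true_and, Fin.exists_fin_succ,
      Fin.cons_zero, Fin.cons_succ, mem_insert]
    constructor
    · rintro ⟨h1 | h1, h2⟩
      · exact Or.inl h1.symm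
      · exact Or.inr ⟨h1, h2⟩
    · rintro (h1 | ⟨h1, h2⟩)
      · exact ⟨Or.inl h1.symm, by rw [h1]; simpa using h⟩
      · exact ⟨Or.inr h1, h2⟩

theorem card_filter_mk_mem {V : Type*} [Fintype V] [DecidableEq V] (E : Finset (Sym2 V))
    (hE : ∀ e ∈ E, ¬ e.IsDiag) : #{q : V × V | s(q.1, q.2) ∈ E} = 2 * #E := by
  rw [card_eq_sum_card_fiberwise (f := fun q : V × V => s(q.1, q.2)) (t := E)
    (fun q hq => by simpa using hq), sum_const_nat (m := 2), mul_comm]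
  intro e he
  induction e using Sym2.ind with
  | _ a b =>
    have hab : a ≠ b := by simpa using hE _ he
    have : ({q ∈ ({q : V × V | s(q.1, q.2) ∈ E} : Finset _) | s(q.1, q.2) = s(a, b)} : Finset _)
        = {(a, b), (b, a)} := by
      ext ⟨c, d⟩
      simp only [mem_filter, mem_univ, true_and, mem_insert, mem_singleton, Prod.mk.injEq,
        Sym2.eq_iff]
      constructor
      · exact fun h => h.2
      · intro h
        refine ⟨?_, h⟩
        rwa [show s(c, d) = s(a, b) from Sym2.eq_iff.2 h]
    rw [this, card_pair]
    simpa using fun h => absurd h hab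

theorem card_properEdges_eq {V : Type*} [Fintype V] [DecidableEq V] (L : ℕ) (E : Finset (Sym2 V))
    (hE : ∀ e ∈ E, ¬ e.IsDiag) :
    #{z : Fin L → V × V | properEdges z = E} = coverCount (Fintype.card V) L #E := by
  induction L generalizing E with
  | zero =>
    rw [coverCount_zero]
    have : ∀ z : Fin 0 → V × V, properEdges z = ∅ := fun z => by simp [properEdges]
    simp only [this]
    by_cases h : E = ∅
    · simp [h]
    · simp [h, Ne.symm h]
  | succ L ih =>
    have h0 : #{z : Fin (L + 1) → V × V | properEdges z = E}
        = ∑ q : V × V, #{z : Fin L → V × V |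
            properEdges (Fin.cons q z : Fin (L + 1) → V × V) = E} := by
      simp only [card_filter]
      rw [← Fintype.sum_prod_type', ← Equiv.sum_comp (Fin.consEquiv fun _ : Fin (L + 1) => V × V)]
      rfl
    have h1 : ∀ q : V × V, #{z : Fin L → V × V |
          properEdges (Fin.cons q z : Fin (L + 1) → V × V) = E}
        = (if q.1 = q.2 then coverCount (Fintype.card V) L #E else 0)
          + if s(q.1, q.2) ∈ E then coverCount (Fintype.card V) L #E
              + coverCount (Fintype.card V) L (#E - 1) else 0 := by
      intro q
      simp only [properEdges_cons]
      by_cases hq : q.1 = q.2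
      · have : s(q.1, q.2) ∉ E := fun h => hE _ h (by simpa using hq)
        simp only [if_pos hq, if_neg this, add_zero, ih E hE]
      · simp only [if_neg hq, zero_add]
        split_ifs with hm
        · rw [← ih E hE, ← card_erase_of_mem hm, ← ih _ fun e he => hE e (mem_of_mem_erase he),
            ← card_union_of_disjoint]
          · congr 1
            ext z
            simp only [mem_filter, mem_univ, true_and, mem_union]
            constructor
            · intro h
              by_cases hz : s(q.1, q.2) ∈ properEdges z
              · left; rwa [insert_eq_of_mem hz] at h
              · right; rw [← h, erase_insert hz]
            · rintro (h | h)
              · rw [h, insert_eq_of_mem hm]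
              · rw [h, insert_erase hm]
          · rw [disjoint_filter]
            intro z _ h h'
            rw [h] at h'
            exact (notMem_erase _ E) (h' ▸ hm)
        · rw [card_eq_zero, filter_eq_empty_iff]
          intro z _ h
          exact hm (h ▸ mem_insert_self _ _)
    rw [h0, sum_congr rfl fun q _ => h1 q, sum_add_distrib, ← sum_filter, ← sum_filter, sum_const,
      sum_const, card_filter_mk_mem E hE, coverCount_succ]
    have h2 : #{q : V × V | q.1 = q.2} = Fintype.card V := by
      have : ({q : V × V | q.1 = q.2} : Finset (V × V)) = (univ : Finset V).diag := by
        ext q; simp [Finset.mem_diag]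
      rw [this, diag_card, card_univ]
    rw [h2]; simp

/-! ### Cayley's lower bound for rooted forests -/

/-- Iterating the parent map `p` from a vertex leads into the set `S`. -/
inductive Reaches {V : Type*} (p : V → V) (S : Finset V) : V → Prop
  | base {v : V} (h : v ∈ S) : Reaches p S v
  | step {v : V} (h : Reaches p S (p v)) : Reaches p S v

/-- A vertex that reaches the roots lies on no cycle of length one or two of the parent map. -/
theorem Reaches.no_two_cycle {V : Type*} {p : V → V} {A S : Finset V} (hAS : Disjoint A S) {v : V}
    (h : Reaches p S v) : ¬ (v ∈ A ∧ p v ∈ A ∧ p (p v) = v) := by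
  induction h with
  | base hv => exact fun h => disjoint_left.1 hAS h.1 hv
  | step _ ih =>
    rintro ⟨h1, h2, h3⟩
    exact ih ⟨h2, by rwa [h3], by rw [h3]⟩

open Classical in
/-- Forests on `A ∪ S` with set of roots `S`, given by their parent maps, which fix every vertex
outside `A`. -/
noncomputable def rootedForests {V : Type*} [Fintype V] [DecidableEq V] (A S : Finset V) :
    Finset (V → V) :=
  {p ∈ Fintype.piFinset fun v => if v ∈ A then A ∪ S else {v} | ∀ v ∈ A, Reaches p S v}

section

variable {V : Type*} [Fintype V] [DecidableEq V]

theorem mem_rootedForests {A S : Finset V} {p : V → V} :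
    p ∈ rootedForests A S ↔
      (∀ v ∈ A, p v ∈ A ∪ S) ∧ (∀ v ∉ A, p v = v) ∧ ∀ v ∈ A, Reaches p S v := by
  simp only [rootedForests, mem_filter, Fintype.mem_piFinset]
  constructor
  · rintro ⟨h1, h2⟩
    refine ⟨fun v hv => by simpa only [if_pos hv] using h1 v,
      fun v hv => by simpa only [if_neg hv, mem_singleton] using h1 v, h2⟩
  · rintro ⟨h1, h2, h3⟩
    refine ⟨fun v => ?_, h3⟩
    split_ifs with hv
    · exact h1 v hv
    · exact mem_singleton.2 (h2 v hv)

/-- Forests in which exactly the vertices of `I` are children of roots: such a forest arises from an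
arbitrary map `I → S` and a forest with set of roots `I` on the remaining vertices. -/
theorem card_layer_le (A S I : Finset V) (hAS : Disjoint A S) (hI : I ⊆ A) :
    #S ^ #I * #(rootedForests (A \ I) I)
      ≤ #{p ∈ rootedForests A S | {v ∈ A | p v ∈ S} = I} := by
  have hQ : #(Fintype.piFinset fun v => if v ∈ I then S else {v}) = #S ^ #I := by
    rw [Fintype.card_piFinset]
    simp only [apply_ite card, card_singleton]
    rw [prod_ite]; simp
  rw [← hQ, ← card_product]
  refine card_le_card_of_injOn (fun qp v => if v ∈ I then qp.1 v else qp.2 v) ?_ ?_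
  · rintro ⟨q, p⟩ hqp
    simp only [coe_product, Set.mem_prod, mem_coe, Fintype.mem_piFinset, mem_rootedForests] at hqp
    obtain ⟨hq, hp1, hp2, hp3⟩ := hqp
    have hq1 : ∀ v ∈ I, q v ∈ S := fun v hv => by simpa only [if_pos hv] using hq v
    have hA : ∀ v ∈ A, v ∉ I → p v ∈ A := fun v hv hvI => by
      have := hp1 v (mem_sdiff.2 ⟨hv, hvI⟩)
      rw [sdiff_union_of_subset hI] at this
      exact this
    simp only [mem_coe, mem_filter, mem_rootedForests]
    refine ⟨⟨fun v hv => ?_, fun v hv => ?_, fun v hv => ?_⟩, ?_⟩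
    · split_ifs with h
      · exact mem_union_right _ (hq1 v h)
      · exact mem_union_left _ (hA v hv h)
    · rw [if_neg fun h => hv (hI h)]
      exact hp2 v fun h => hv (mem_sdiff.1 h).1
    · have hI' : ∀ v ∈ I, Reaches (fun v => if v ∈ I then q v else p v) S v := fun v hv =>
        .step (.base (by simpa only [if_pos hv] using hq1 v hv))
      have key : ∀ v, Reaches p I v → Reaches (fun v => if v ∈ I then q v else p v) S v := by
        intro v h
        induction h with
        | base h => exact hI' _ h
        | @step v _ ih =>
          by_cases hvI : v ∈ I
          · exact hI' _ hvI
          · exact .step (by simpa only [if_neg hvI] using ih)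
      by_cases hvI : v ∈ I
      · exact hI' v hvI
      · exact key v (hp3 v (mem_sdiff.2 ⟨hv, hvI⟩))
    · ext v
      simp only [mem_filter]
      constructor
      · rintro ⟨hv, h⟩
        by_contra hvI
        rw [if_neg hvI] at h
        exact disjoint_left.1 hAS (hA v hv hvI) h
      · intro h
        exact ⟨hI h, by rw [if_pos h]; exact hq1 v h⟩
  · rintro ⟨q, p⟩ hqp ⟨q', p'⟩ hqp' h
    simp only [coe_product, Set.mem_prod, mem_coe, Fintype.mem_piFinset, mem_rootedForests]
      at hqp hqp'
    have h' : ∀ v, (if v ∈ I then q v else p v) = if v ∈ I then q' v else p' v := congrFun h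
    rw [Prod.mk.injEq]
    constructor
    · funext v
      by_cases hv : v ∈ I
      · simpa only [if_pos hv] using h' v
      · have h1 := hqp.1 v
        have h2 := hqp'.1 v
        rw [if_neg hv, mem_singleton] at h1 h2
        rw [h1, h2]
    · funext v
      by_cases hv : v ∈ I
      · have hv' : v ∉ A \ I := fun h => (mem_sdiff.1 h).2 hv
        rw [hqp.2.2.1 v hv', hqp'.2.2.1 v hv']
      · simpa only [if_neg hv] using h' v

/-- Lower bound in Cayley's formula `#S * (#A + #S) ^ (#A - 1)` for rooted forests, multiplied by
`#A + #S` to avoid the subtraction. -/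
theorem le_card_rootedForests (A S : Finset V) (hAS : Disjoint A S) :
    #S * (#A + #S) ^ #A ≤ #(rootedForests A S) * (#A + #S) := by
  induction hn : #A using Nat.strong_induction_on generalizing A S with
  | _ n ih =>
    subst hn
    rcases Finset.eq_empty_or_nonempty A with rfl | hA
    · have : (id : V → V) ∈ rootedForests ∅ S := mem_rootedForests.2 (by simp)
      have := card_pos.2 ⟨_, this⟩
      simp only [card_empty, pow_zero, mul_one, zero_add]
      exact Nat.le_mul_of_pos_left _ this
    · obtain ⟨m, hm⟩ : ∃ m, #A = m + 1 := ⟨#A - 1, by have := hA.card_pos; omega⟩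
      -- Sum over the set `I` of the children of the roots, with the inductive hypothesis for the
      -- forest hanging from `I`; the resulting sum is evaluated by the binomial theorem.
      have h1 : ∑ I ∈ A.powerset, #S ^ #I * (#I * #A ^ (#A - #I))
          ≤ #A * #(rootedForests A S) := by
        rw [card_eq_sum_card_fiberwise (s := rootedForests A S) (t := A.powerset)
          (f := fun p => {v ∈ A | p v ∈ S}) fun p _ => by
            exact mem_coe.2 (mem_powerset.2 (filter_subset _ _)), mul_sum]
        refine sum_le_sum fun I hI => ?_
        rw [mem_powerset] at hI
        refine le_trans ?_ (Nat.mul_le_mul_left _ (card_layer_le A S I hAS hI))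
        rcases Finset.eq_empty_or_nonempty I with rfl | hI0
        · simp
        have hc := card_le_card hI
        have h2 := ih #(A \ I) (by rw [card_sdiff_of_subset hI]; have := hI0.card_pos; omega)
          (A \ I) I sdiff_disjoint rfl
        rw [card_sdiff_of_subset hI, Nat.sub_add_cancel hc] at h2
        calc _ ≤ #S ^ #I * (#(rootedForests (A \ I) I) * #A) := by gcongr
          _ = _ := by ring
      rw [Finset.sum_powerset_apply_card (fun i => #S ^ i * (i * #A ^ (#A - i))), hm,
        sum_range_succ'] at h1
      simp only [smul_eq_mul, zero_mul, mul_zero, add_zero] at h1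
      have h2 : ∑ j ∈ range (m + 1), (m + 1).choose (j + 1) *
            (#S ^ (j + 1) * ((j + 1) * (m + 1) ^ (m + 1 - (j + 1))))
          = (m + 1) * (#S * (m + 1 + #S) ^ m) := by
        rw [add_comm (m + 1) #S, add_pow, mul_sum, mul_sum]
        refine sum_congr rfl fun j _ => ?_
        have := Nat.add_one_mul_choose_eq m j
        rw [Nat.add_sub_add_right]
        calc _ = ((m + 1).choose (j + 1) * (j + 1)) * (#S ^ (j + 1) * (m + 1) ^ (m - j)) := by ring
          _ = _ := by rw [← this]; simp; ring
      rw [h2] at h1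
      have h3 := Nat.le_of_mul_le_mul_left h1 (Nat.succ_pos m)
      rw [hm, pow_succ, ← mul_assoc]
      exact Nat.mul_le_mul_right _ h3

/-- The edge from a vertex to its parent determines the vertex, so that a forest has as many edges
as vertices that are not roots. -/
theorem eq_of_mk_eq {A S : Finset V} (hAS : Disjoint A S) {p : V → V} (hp : p ∈ rootedForests A S)
    {v w : V} (hv : v ∈ A) (hw : w ∈ A) (h : s(v, p v) = s(w, p w)) : v = w := by
  rw [mem_rootedForests] at hp
  rcases Sym2.eq_iff.1 h with h | ⟨h1, h2⟩
  · exact h.1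
  · refine absurd ⟨hv, by rwa [h2], by rw [h2, ← h1]⟩ ((hp.2.2 v hv).no_two_cycle hAS)

theorem parent_ne {A S : Finset V} (hAS : Disjoint A S) {p : V → V} (hp : p ∈ rootedForests A S)
    {v : V} (hv : v ∈ A) : v ≠ p v := by
  rw [mem_rootedForests] at hp
  intro h
  exact (hp.2.2 v hv).no_two_cycle hAS ⟨hv, h ▸ hv, by rw [← h, ← h]⟩

/-- A forest is determined by its roots and its edges; the parents are recovered in order of
increasing distance from the roots. -/
theorem rootedForests_ext {A S : Finset V} (hAS : Disjoint A S) {p p' : V → V}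
    (hp : p ∈ rootedForests A S) (hp' : p' ∈ rootedForests A S)
    (h : ∀ v ∈ A, ∃ w ∈ A, s(w, p' w) = s(v, p v)) : p = p' := by
  rw [mem_rootedForests] at hp hp'
  have key : ∀ v, Reaches p S v → p v = p' v := by
    intro v hv
    induction hv with
    | base hv =>
      have := disjoint_right.1 hAS hv
      rw [hp.2.1 _ this, hp'.2.1 _ this]
    | @step v hr ih =>
      by_cases hv : v ∈ A
      · obtain ⟨w, hw, hvw⟩ := h v hv
        rcases Sym2.eq_iff.1 hvw with ⟨rfl, h2⟩ | ⟨rfl, h2⟩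
        · exact h2.symm
        · exact absurd ⟨hv, hw, by rw [ih, h2]⟩ ((Reaches.step hr).no_two_cycle hAS)
      · rw [hp.2.1 _ hv, hp'.2.1 _ hv]
  funext v
  by_cases hv : v ∈ A
  · exact key v (hp.2.2 v hv)
  · rw [hp.2.1 _ hv, hp'.2.1 _ hv]

end

/-! ### Forests with prescribed component sizes -/

/-- The components of a forest of type `k`: `k i` components of size `i + 1`. -/
abbrev Block {L : ℕ} (k : Fin (L + 1) → ℕ) : Type := Σ i : Fin (L + 1), Fin (k i)

/-- The vertices of the standard forest of type `k`: the pairs of a component and a position in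
it. -/
abbrev Cell {L : ℕ} (k : Fin (L + 1) → ℕ) : Type := Σ b : Block k, Fin ((b.1 : ℕ) + 1)

/-- The cells other than the roots. -/
def nonroots {L : ℕ} (k : Fin (L + 1) → ℕ) : Finset (Cell k) := {x | x.2 ≠ 0}

/-- Position `0` is the root of its component. -/
def roots {L : ℕ} (k : Fin (L + 1) → ℕ) : Finset (Cell k) := {x | x.2 = 0}

/-- A parent map on every component. -/
abbrev ParentMaps {L : ℕ} (k : Fin (L + 1) → ℕ) : Type :=
  ∀ b : Block k, Fin ((b.1 : ℕ) + 1) → Fin ((b.1 : ℕ) + 1)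

/-- The families of trees, one on every component, rooted at position `0`. -/
noncomputable def treeFamilies {L : ℕ} (k : Fin (L + 1) → ℕ) : Finset (ParentMaps k) :=
  Fintype.piFinset fun _ => rootedForests {0}ᶜ {0}

/-- The parent map on all cells assembled from those of the components. -/
def glue {L : ℕ} {k : Fin (L + 1) → ℕ} (P : ParentMaps k) (x : Cell k) : Cell k :=
  ⟨x.1, P x.1 x.2⟩

/-- The edge set of the forest on `V` obtained by transporting a family of trees along a labelling
`e` of the cells by `V`. -/
def forestEdges {L : ℕ} {k : Fin (L + 1) → ℕ} {V : Type*} [DecidableEq V] (e : V ≃ Cell k)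
    (P : ParentMaps k) : Finset (Sym2 V) :=
  (nonroots k).image fun x => s(e.symm x, e.symm (glue P x))

/-- The edge sets of the forests on `V` with `k i` components of size `i + 1` for every `i`. -/
noncomputable def forestsOfType {L : ℕ} (k : Fin (L + 1) → ℕ) (V : Type*) [Fintype V]
    [DecidableEq V] : Finset (Finset (Sym2 V)) :=
  ((univ : Finset (V ≃ Cell k)) ×ˢ treeFamilies k).image fun q => forestEdges q.1 q.2

/-- The coloring `φ` takes the same value at the two ends of every edge in `E`. -/
def ConstOn {V C : Type*} (E : Finset (Sym2 V)) (φ : V → C) : Prop :=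
  ∀ u v, s(u, v) ∈ E → φ u = φ v

section

variable {L : ℕ} {k : Fin (L + 1) → ℕ}

theorem card_block_fiber (i : Fin (L + 1)) : #{b : Block k | b.1 = i} = k i := by
  have : ({b : Block k | b.1 = i} : Finset (Block k))
      = ({i} : Finset (Fin (L + 1))).sigma fun i => (univ : Finset (Fin (k i))) := by
    ext b; simp
  rw [this, card_sigma]; simp

theorem card_cell_fiber (b : Block k) : #{x : Cell k | x.1 = b} = (b.1 : ℕ) + 1 := by
  have : ({x : Cell k | x.1 = b} : Finset (Cell k))
      = ({b} : Finset (Block k)).sigma fun b => (univ : Finset (Fin ((b.1 : ℕ) + 1))) := by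
    ext b; simp
  rw [this, card_sigma]; simp

theorem card_cell : Fintype.card (Cell k) = gamHat k := by
  simp only [Fintype.card_sigma, Fintype.card_fin, Fintype.sum_sigma, sum_const, card_univ,
    smul_eq_mul, gamHat]
  exact sum_congr rfl fun i _ => mul_comm _ _

theorem card_nonroots : #(nonroots k) = gam k := by
  have h : nonroots k = (univ : Finset (Block k)).sigma fun b =>
      ({t | t ≠ 0} : Finset (Fin ((b.1 : ℕ) + 1))) := by
    ext x; simp [nonroots]
  rw [h, card_sigma, Fintype.sum_sigma]
  simp only [gam, filter_ne', card_erase_of_mem (mem_univ _), card_univ, Fintype.card_fin,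
    Nat.add_sub_cancel, sum_const, smul_eq_mul]
  exact sum_congr rfl fun i _ => mul_comm _ _

theorem disjoint_nonroots_roots : Disjoint (nonroots k) (roots k) := by
  rw [disjoint_left]
  intro x hx hx'
  simp only [nonroots, roots, mem_filter, mem_univ, true_and] at hx hx'
  exact hx hx'

theorem glue_mem {P : ParentMaps k} (hP : P ∈ treeFamilies k) :
    glue P ∈ rootedForests (nonroots k) (roots k) := by
  simp only [treeFamilies, Fintype.mem_piFinset, mem_rootedForests] at hP
  rw [mem_rootedForests]
  refine ⟨fun x _ => ?_, fun x hx => ?_, fun x hx => ?_⟩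
  · by_cases h : (glue P x).2 = 0 <;> simp [nonroots, roots, h]
  · have hx0 : x.2 = 0 := by simpa [nonroots] using hx
    obtain ⟨b, t⟩ := x
    have := (hP b).2.1 t (by simpa using hx0)
    simp only [glue, this]
  · have key : ∀ b t, Reaches (P b) {0} t → Reaches (glue P) (roots k) ⟨b, t⟩ := by
      intro b t h
      induction h with
      | base h => exact .base (by simpa [roots] using h)
      | step _ ih => exact .step ih
    obtain ⟨b, t⟩ := x
    exact key b t ((hP b).2.2 t (by simpa [nonroots] using hx))

theorem glue_injective : Function.Injective (glue (k := k)) := by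
  intro P P' h
  funext b t
  have := congrFun h ⟨b, t⟩
  simpa [glue] using this

theorem le_card_treeFamilies :
    ∏ i : Fin (L + 1), (((i : ℕ) + 1) ^ ((i : ℕ) - 1)) ^ k i ≤ #(treeFamilies k) := by
  have h1 : ∀ n : ℕ, (n + 1) ^ (n - 1)
      ≤ #(rootedForests ({0}ᶜ : Finset (Fin (n + 1))) {0}) := by
    intro n
    have h := le_card_rootedForests ({0}ᶜ : Finset (Fin (n + 1))) {0}
      (disjoint_compl_left)
    rw [card_compl, card_singleton, Fintype.card_fin, Nat.add_sub_cancel, one_mul] at h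
    cases n with
    | zero => simpa using h
    | succ n =>
      rw [pow_succ] at h
      exact Nat.le_of_mul_le_mul_right h (Nat.succ_pos _)
  rw [treeFamilies, Fintype.card_piFinset, Fintype.prod_sigma]
  refine prod_le_prod' fun i _ => ?_
  calc _ = ∏ _j : Fin (k i), ((i : ℕ) + 1) ^ ((i : ℕ) - 1) := by simp
    _ ≤ _ := prod_le_prod' fun _ _ => h1 i

theorem card_same_block {V : Type*} [Fintype V] (e : V ≃ Cell k) (b : Block k) :
    #{v : V | (e v).1 = b} = (b.1 : ℕ) + 1 := by
  rw [← card_cell_fiber b]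
  exact card_equiv e fun v => by simp

variable {V : Type*} [DecidableEq V]

theorem card_forestEdges (e : V ≃ Cell k) {P : ParentMaps k} (hP : P ∈ treeFamilies k) :
    #(forestEdges e P) = gam k := by
  rw [← card_nonroots, forestEdges]
  refine card_image_of_injOn fun x hx y hy h => ?_
  refine eq_of_mk_eq disjoint_nonroots_roots (glue_mem hP) hx hy ?_
  have := congrArg (Sym2.map e) h
  simpa using this

theorem not_isDiag_of_mem_forestEdges (e : V ≃ Cell k) {P : ParentMaps k}
    (hP : P ∈ treeFamilies k) {a : Sym2 V} (ha : a ∈ forestEdges e P) : ¬ a.IsDiag := by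
  simp only [forestEdges, mem_image] at ha
  obtain ⟨x, hx, rfl⟩ := ha
  rw [Sym2.mk_isDiag_iff, e.symm.injective.eq_iff]
  exact parent_ne disjoint_nonroots_roots (glue_mem hP) hx

/-- A coloring is constant along the edges if and only if it is constant on the components. -/
theorem constOn_forestEdges_iff {C : Type*} (e : V ≃ Cell k) {P : ParentMaps k}
    (hP : P ∈ treeFamilies k) (φ : V → C) :
    ConstOn (forestEdges e P) φ ↔ ∀ x : Cell k, φ (e.symm x) = φ (e.symm ⟨x.1, 0⟩) := by
  constructor
  · intro h
    have h1 : ∀ x ∈ nonroots k, φ (e.symm x) = φ (e.symm (glue P x)) := fun x hx =>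
      h _ _ (mem_image_of_mem _ hx)
    have key : ∀ x, Reaches (glue P) (roots k) x → φ (e.symm x) = φ (e.symm ⟨x.1, 0⟩) := by
      intro x hx
      induction hx with
      | @base x hx =>
        obtain ⟨b, t⟩ := x
        have : t = 0 := by simpa [roots] using hx
        rw [this]
      | @step x hx ih =>
        by_cases hxA : x ∈ nonroots k
        · rw [h1 x hxA, ih]; rfl
        · rwa [(mem_rootedForests.1 (glue_mem hP)).2.1 x hxA] at ih
    intro x
    by_cases hxA : x ∈ nonroots k
    · exact key x ((mem_rootedForests.1 (glue_mem hP)).2.2 x hxA)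
    · exact key x (.base (by simpa [roots, nonroots] using hxA))
  · intro h u v huv
    simp only [forestEdges, mem_image] at huv
    obtain ⟨x, -, hx⟩ := huv
    have h2 : φ (e.symm x) = φ (e.symm (glue P x)) := by rw [h x, h (glue P x)]; rfl
    rcases Sym2.eq_iff.1 hx with ⟨rfl, rfl⟩ | ⟨rfl, rfl⟩
    · exact h2
    · exact h2.symm

theorem constOn_block {e : V ≃ Cell k} {P : ParentMaps k} (hP : P ∈ treeFamilies k) :
    ConstOn (forestEdges e P) fun v => (e v).1 := by
  rw [constOn_forestEdges_iff e hP]; simp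

/-- The edges determine the partition into components, as the coloring of the vertices by their
component in one forest is constant along the edges of the other. -/
theorem block_eq_of_forestEdges_eq {k' : Fin (L + 1) → ℕ} {e : V ≃ Cell k} {e' : V ≃ Cell k'}
    {P : ParentMaps k} {P' : ParentMaps k'} (hP : P ∈ treeFamilies k) (hP' : P' ∈ treeFamilies k')
    (h : forestEdges e P = forestEdges e' P') {u v : V} (huv : (e u).1 = (e v).1) :
    (e' u).1 = (e' v).1 := by
  have h1 := (constOn_forestEdges_iff e hP fun v => (e' v).1).1 (by rw [h]; exact constOn_block hP')
  have h2 := h1 (e u)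
  have h3 := h1 (e v)
  simp only [Equiv.symm_apply_apply] at h2 h3
  rw [h2, h3, huv]

variable [Fintype V]

/-- The type of a forest is determined by its edges: exactly `k i * (i + 1)` vertices lie in a
component of size `i + 1`. -/
theorem type_eq_of_forestEdges_eq {k' : Fin (L + 1) → ℕ} {e : V ≃ Cell k} {e' : V ≃ Cell k'}
    {P : ParentMaps k} {P' : ParentMaps k'} (hP : P ∈ treeFamilies k) (hP' : P' ∈ treeFamilies k')
    (h : forestEdges e P = forestEdges e' P') : k = k' := by
  have hcount : ∀ {k : Fin (L + 1) → ℕ} (e : V ≃ Cell k) (i : Fin (L + 1)),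
      #{v : V | #{w : V | (e w).1 = (e v).1} = (i : ℕ) + 1} = k i * ((i : ℕ) + 1) := by
    intro k e i
    simp only [card_same_block, Nat.add_right_cancel_iff, Fin.val_inj]
    have h1 : #{v : V | (e v).1.1 = i} = #{x : Cell k | x.1.1 = i} :=
      card_equiv e fun v => by simp
    have h2 : ({x : Cell k | x.1.1 = i} : Finset (Cell k))
        = ({b : Block k | b.1 = i} : Finset (Block k)).sigma
          fun b => (univ : Finset (Fin ((b.1 : ℕ) + 1))) := by
      ext x; simp
    rw [h1, h2, card_sigma, ← card_block_fiber (k := k) i, sum_const_nat]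
    intro b hb
    rw [mem_filter] at hb
    simp [hb.2]
  funext i
  have h1 : ∀ u v, (e u).1 = (e v).1 ↔ (e' u).1 = (e' v).1 := fun u v =>
    ⟨block_eq_of_forestEdges_eq hP hP' h, block_eq_of_forestEdges_eq hP' hP h.symm⟩
  have h2 := hcount e i
  simp only [h1] at h2
  rw [hcount e' i] at h2
  exact (Nat.eq_of_mul_eq_mul_right (Nat.succ_pos _) h2).symm

/-- The labellings that induce the same partition of the vertices as `e₀` differ from it by a
permutation of the components of equal size and permutations inside the components. -/
theorem card_same_partition_le (e₀ : V ≃ Cell k) :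
    #{e : V ≃ Cell k | ∀ u v, (e u).1 = (e v).1 ↔ (e₀ u).1 = (e₀ v).1}
      ≤ (∏ i, (k i).factorial) * ∏ i : Fin (L + 1), ((i : ℕ) + 1).factorial ^ k i := by
  have hsub : ({e : V ≃ Cell k | ∀ u v, (e u).1 = (e v).1 ↔ (e₀ u).1 = (e₀ v).1} : Finset _)
      ⊆ ({τ : Block k ≃ Block k | ∀ b, (τ b).1 = b.1} : Finset _).biUnion
        fun τ => {e : V ≃ Cell k | ∀ v, (e v).1 = τ (e₀ v).1} := by
    intro e he
    simp only [mem_filter, mem_univ, true_and] at he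
    let τ₀ : Block k → Block k := fun b => (e (e₀.symm ⟨b, 0⟩)).1
    have hτ : ∀ v, (e v).1 = τ₀ (e₀ v).1 := fun v => by
      simp only [τ₀, he, Equiv.apply_symm_apply]
    have hinj : Function.Injective τ₀ := fun b b' h => by
      simpa only [τ₀, he, Equiv.apply_symm_apply] using h
    simp only [mem_biUnion, mem_filter, mem_univ, true_and]
    refine ⟨Equiv.ofBijective τ₀ (Finite.injective_iff_bijective.1 hinj), fun b => ?_, hτ⟩
    have h1 := card_same_block e (τ₀ b)
    simp only [hτ, hinj.eq_iff, card_same_block] at h1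
    exact Fin.ext (by simpa using h1.symm)
  refine (card_le_card hsub).trans ((card_biUnion_le_card_mul _ _
    (∏ i : Fin (L + 1), ((i : ℕ) + 1).factorial ^ k i) fun τ _ => ?_).trans
    (Nat.mul_le_mul_right _ ?_))
  · refine (card_equiv_comp_le (fun x : Cell k => x.1) fun v => τ (e₀ v).1).trans (le_of_eq ?_)
    simp only [card_cell_fiber, Fintype.prod_sigma, prod_const, card_univ, Fintype.card_fin]
  · have h := card_equiv_comp_le (A := Block k) (B := Block k) (C := Fin (L + 1))
      Sigma.fst Sigma.fst
    simp only [card_block_fiber] at h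
    convert h

/-- Lower bound for the number of forests of type `k`: a forest comes from at most
`∏ i, (k i)! * (i + 1)! ^ k i` pairs of a labelling and a family of trees, because its edges
determine the partition and, given the labelling, the trees. -/
theorem le_card_forestsOfType (hk : gamHat k = Fintype.card V) :
    (Fintype.card V).factorial * ∏ i : Fin (L + 1), (((i : ℕ) + 1) ^ ((i : ℕ) - 1)) ^ k i
      ≤ ((∏ i, (k i).factorial) * ∏ i : Fin (L + 1), ((i : ℕ) + 1).factorial ^ k i)
        * #(forestsOfType k V) := by
  have h0 : Fintype.card (V ≃ Cell k) = (Fintype.card V).factorial :=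
    Fintype.card_equiv (Fintype.equivOfCardEq (by rw [card_cell, hk]))
  refine (Nat.mul_le_mul_left _ le_card_treeFamilies).trans ?_
  rw [← h0, ← card_univ, ← card_product, forestsOfType]
  refine card_le_mul_card_image _ _ fun E hE => ?_
  rw [mem_image] at hE
  obtain ⟨⟨e₀, P₀⟩, h₀, rfl⟩ := hE
  rw [mem_product] at h₀
  refine le_trans (card_le_card_of_injOn Prod.fst ?_ ?_) (card_same_partition_le e₀)
  · rintro ⟨e, P⟩ h
    simp only [coe_filter, mem_product, mem_univ, true_and, Set.mem_ofPred_eq] at h ⊢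
    exact fun u v => ⟨block_eq_of_forestEdges_eq h.1 h₀.2 h.2,
      block_eq_of_forestEdges_eq h₀.2 h.1 h.2.symm⟩
  · rintro ⟨e, P⟩ h ⟨e', P'⟩ h' (rfl : e = e')
    simp only [coe_filter, mem_product, mem_univ, true_and, Set.mem_ofPred_eq] at h h'
    rw [Prod.mk.injEq]
    refine ⟨rfl, glue_injective (rootedForests_ext disjoint_nonroots_roots (glue_mem h.1)
      (glue_mem h'.1) fun x hx => ?_)⟩
    have hm : s(e.symm x, e.symm (glue P x)) ∈ forestEdges e P' := by
      rw [h'.2, ← h.2]; exact mem_image_of_mem _ hx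
    simp only [forestEdges, mem_image] at hm
    obtain ⟨y, hy, hxy⟩ := hm
    refine ⟨y, hy, ?_⟩
    have := congrArg (Sym2.map e) hxy
    simpa using this

/-- The equipartitions that are constant on the components of a forest of type `k`. The matrix of
such a coloring records how many components of each size receive each color. -/
theorem card_colorings (nc m : ℕ) (nw : ℕ) (hm : nw / nc = m) (e : V ≃ Cell k) :
    (#{φ : V → Fin nc | (∀ c, #{v | φ v = c} = m) ∧
        ∀ x : Cell k, φ (e.symm x) = φ (e.symm ⟨x.1, 0⟩)} : ℝ)
      = ∑ A ∈ admissible nw nc k, ∏ i : Fin (L + 1),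
          ((k i).factorial : ℝ) / ∏ j : Fin nc, ((A i j).factorial : ℝ) := by
  have h1 : #{φ : V → Fin nc | (∀ c, #{v | φ v = c} = m) ∧
        ∀ x : Cell k, φ (e.symm x) = φ (e.symm ⟨x.1, 0⟩)}
      = #{χ : ∀ i, Fin (k i) → Fin nc |
          ∀ c, ∑ i : Fin (L + 1), ((i : ℕ) + 1) * #{j | χ i j = c} = m} := by
    have hfib : ∀ (χ : ∀ i, Fin (k i) → Fin nc) (c : Fin nc),
        #{v | χ (e v).1.1 (e v).1.2 = c}
          = ∑ i : Fin (L + 1), ((i : ℕ) + 1) * #{j | χ i j = c} := by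
      intro χ c
      have h1 : #{v | χ (e v).1.1 (e v).1.2 = c} = #{x : Cell k | χ x.1.1 x.1.2 = c} :=
        card_equiv e fun v => by simp
      have h2 : ({x : Cell k | χ x.1.1 x.1.2 = c} : Finset (Cell k))
          = ({b : Block k | χ b.1 b.2 = c} : Finset (Block k)).sigma
            fun b => (univ : Finset (Fin ((b.1 : ℕ) + 1))) := by
        ext x; simp
      rw [h1, h2, card_sigma, sum_filter, Fintype.sum_sigma]
      refine sum_congr rfl fun i _ => ?_
      simp only [card_univ, Fintype.card_fin]
      rw [← sum_filter, sum_const, smul_eq_mul, mul_comm]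
    refine card_bij' (fun φ _ i j => φ (e.symm ⟨⟨i, j⟩, 0⟩))
      (fun χ _ v => χ (e v).1.1 (e v).1.2) ?_ ?_ ?_ ?_
    · intro φ hφ
      simp only [mem_filter, mem_univ, true_and] at hφ ⊢
      intro c
      rw [← hφ.1 c, ← hfib]
      congr 1
      ext v
      simp only [mem_filter, mem_univ, true_and]
      rw [show (⟨⟨(e v).1.1, (e v).1.2⟩, 0⟩ : Cell k) = ⟨(e v).1, 0⟩ from rfl, ← hφ.2 (e v),
        Equiv.symm_apply_apply]
    · intro χ hχ
      simp only [mem_filter, mem_univ, true_and] at hχ ⊢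
      exact ⟨fun c => by rw [hfib, hχ], fun x => by rw [e.apply_symm_apply, e.apply_symm_apply]⟩
    · intro φ hφ
      simp only [mem_filter, mem_univ, true_and] at hφ
      funext v
      have := hφ.2 (e v)
      rw [Equiv.symm_apply_apply] at this
      exact this.symm
    · intro χ _
      funext i j
      change χ (e (e.symm ⟨⟨i, j⟩, 0⟩)).1.1 (e (e.symm ⟨⟨i, j⟩, 0⟩)).1.2 = χ i j
      rw [e.apply_symm_apply]
  rw [h1, card_eq_sum_card_fiberwise (t := admissible nw nc k)
    (f := fun χ i c => #{j | χ i j = c})]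
  · rw [Nat.cast_sum]
    refine sum_congr rfl fun A hA => ?_
    rw [mem_admissible] at hA
    have h2 : ({χ ∈ ({χ : ∀ i, Fin (k i) → Fin nc |
          ∀ c, ∑ i : Fin (L + 1), ((i : ℕ) + 1) * #{j | χ i j = c} = m} : Finset _) |
          (fun i c => #{j | χ i j = c}) = A} : Finset _)
        = Fintype.piFinset fun i => {f : Fin (k i) → Fin nc | ∀ c, #{j | f j = c} = A i c} := by
      ext χ
      simp only [mem_filter, mem_univ, true_and, Fintype.mem_piFinset]
      constructor
      · rintro ⟨-, rfl⟩ i c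
        rfl
      · intro h
        refine ⟨fun c => ?_, funext fun i => funext fun c => h i c⟩
        simp only [h, hA.1 c, hm]
    rw [h2, Fintype.card_piFinset, Nat.cast_prod]
    refine prod_congr rfl fun i _ => ?_
    have h3 := card_fiber_functions (B := Fin (k i)) (A i) (by rw [hA.2 i, Fintype.card_fin])
    rw [Fintype.card_fin] at h3
    rw [eq_div_iff (prod_ne_zero_iff.2 fun j _ => by positivity), ← h3]
    push_cast
    congr!
  · intro χ hχ
    simp only [coe_filter, mem_univ, true_and, Set.mem_ofPred_eq] at hχ
    simp only [mem_coe, mem_admissible]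
    refine ⟨fun c => by rw [hχ c, hm], fun i => ?_⟩
    rw [← card_eq_sum_card_fiberwise (s := (univ : Finset (Fin (k i)))) (fun _ _ => by simp),
      card_univ, Fintype.card_fin]

end

/-! ### Splitting the success event -/

section

theorem sum_comm_three {α β γ δ : Type*} [Fintype α] [Fintype β] [Fintype γ] [Fintype δ]
    (f : δ → α → β → γ → ℝ) :
    ∑ x, ∑ a, ∑ b, ∑ c, f x a b c = ∑ a, ∑ b, ∑ c, ∑ x, f x a b c := by
  rw [sum_comm]
  refine sum_congr rfl fun a _ => ?_
  rw [sum_comm]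
  refine sum_congr rfl fun b _ => ?_
  rw [sum_comm]

theorem sum_pi_prod {ι κ : Type*} [Fintype ι] [DecidableEq ι] [Fintype κ] (f : ι → κ → ℝ) :
    ∑ x : ι → κ, ∏ i, f i (x i) = ∏ i, ∑ j, f i j := by
  rw [prod_univ_sum, Fintype.piFinset_univ]

theorem sum_sample_prod {X : Type*} [Fintype X] {R m : ℕ} (f : Fin R → Fin (m + 2) → X → ℝ) :
    ∑ S : Fin R → Fin (m + 2) → X, ∏ r, ∏ s, f r s (S r s) = ∏ r, ∏ s, ∑ z, f r s z := by
  rw [sum_pi_prod fun r (S : Fin (m + 2) → X) => ∏ s, f r s (S s)]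
  exact prod_congr rfl fun r _ => sum_pi_prod _

/-- Factorization of a sum over `c` in which only the entry `c 0` carries an extra factor. -/
theorem sum_prod_mul_zero {Z : Type*} [Fintype Z] {R : ℕ} [NeZero R] (f : Fin R → Z → ℝ)
    (g : Z → ℝ) :
    ∑ c : Fin R → Z, (∏ r, f r (c r)) * g (c 0)
      = (∑ c, f 0 c * g c) * ∏ r ∈ {(0 : Fin R)}ᶜ, ∑ c, f r c := by
  have h : ∀ c : Fin R → Z, (∏ r, f r (c r)) * g (c 0)
      = ∏ r, f r (c r) * (if r = 0 then g (c r) else 1) := by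
    intro c
    rw [prod_mul_distrib]
    simp
  rw [sum_congr rfl fun c _ => h c, sum_pi_prod fun r c => f r c * (if r = 0 then g c else 1),
    Fintype.prod_eq_mul_prod_compl 0]
  simp only [if_true]
  congr 1
  refine prod_congr rfl fun r hr => ?_
  have : r ≠ 0 := by simpa using hr
  simp [this]

variable {X Z : Type*} {R m : ℕ} [NeZero R]

/-- Weight of a training sample `S` and a test point `x`, where `d c` is the density of the points
generated by the concept `c`: the first point of each category is generated by the unfamiliar
concept `c' r`, the others by the familiar concept `c r`, and the test point by `c' 0`. -/
def sampleWeight (d : Z → X → ℝ) (c c' : Fin R → Z) (S : Fin R → Fin (m + 2) → X) (x : X) : ℝ :=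
  (∏ r, ∏ s : Fin (m + 2), d (if (s : ℕ) = 0 then c' r else c r) (S r s)) * d (c' 0) x

/-- Among the points generated by the familiar concepts, one of category `r₀` is strictly more
similar to `x` than all those of the other categories. -/
def FamiliarWins (K : X → X → ℝ) (x : X) (S : Fin R → Fin (m + 2) → X) (r₀ : Fin R) : Prop :=
  ∃ s, s ≠ 0 ∧ ∀ r, r ≠ r₀ → ∀ s', s' ≠ 0 → K x (S r s') < K x (S r₀ s)

theorem sampleWeight_nonneg {d : Z → X → ℝ} (hd0 : ∀ c z, 0 ≤ d c z) (c c' : Fin R → Z)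
    (S : Fin R → Fin (m + 2) → X) (x : X) : 0 ≤ sampleWeight d c c' S x :=
  mul_nonneg (prod_nonneg fun _ _ => prod_nonneg fun _ _ => hd0 _ _) (hd0 _ _)

/-- The unfamiliar point of category `0` is strictly more similar to `x` than the unfamiliar points
of the other categories and than one familiar point of each category. -/
def UnfamiliarWins (K : X → X → ℝ) (x : X) (S : Fin R → Fin (m + 2) → X) : Prop :=
  (∀ r, r ≠ 0 → K x (S r 0) < K x (S 0 0)) ∧ ∀ r, K x (S r 1) < K x (S 0 0)

/-- If no familiar point of category `0` beats the other categories, then these points are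
themselves beaten by the unfamiliar point. This makes the number of independent competitors
`2 * R - 1` instead of `2 * R - 2`. -/
theorem familiarWins_or_unfamiliarWins {K : X → X → ℝ} {x : X} {S : Fin R → Fin (m + 2) → X}
    (h : ∃ s₀, ∀ r, r ≠ 0 → ∀ s, K x (S r s) < K x (S 0 s₀)) :
    FamiliarWins K x S 0 ∨ UnfamiliarWins K x S := by
  by_cases hF : FamiliarWins K x S 0
  · exact Or.inl hF
  right
  obtain ⟨s₀, h⟩ := h
  by_cases hs₀ : s₀ = 0
  · subst hs₀
    refine ⟨fun r hr => h r hr 0, fun r => ?_⟩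
    by_cases hr : r = 0
    · subst hr
      by_contra hlt
      exact hF ⟨1, by simp, fun r hr s' _ => (h r hr s').trans_le (not_lt.1 hlt)⟩
    · exact h r hr 1
  · exact absurd ⟨s₀, hs₀, fun r hr s' _ => h r hr s'⟩ hF

variable [Fintype X] [Fintype Z]

/-- Integration of a function that is a product of functions of the unfamiliar points `S r 0` and of
one familiar point `S r 1` per category. -/
theorem sum_mul_sampleWeight (d : Z → X → ℝ) (hd : ∀ c, ∑ z, d c z = 1) (a b : Fin R → X → ℝ)
    (x : X) :
    ∑ c : Fin R → Z, ∑ c' : Fin R → Z, ∑ S : Fin R → Fin (m + 2) → X,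
        (∏ r, a r (S r 0) * b r (S r 1)) * sampleWeight d c c' S x
      = (∏ r, ∑ c, ∑ z, b r z * d c z) * ((∑ c, (∑ z, a 0 z * d c z) * d c x)
          * ∏ r ∈ {(0 : Fin R)}ᶜ, ∑ c, ∑ z, a r z * d c z) := by
  have h1 : ∀ c c' : Fin R → Z, ∑ S : Fin R → Fin (m + 2) → X,
        (∏ r, a r (S r 0) * b r (S r 1)) * sampleWeight d c c' S x
      = (∏ r, ∑ z, b r z * d (c r) z) * ((∏ r, ∑ z, a r z * d (c' r) z) * d (c' 0) x) := by
    intro c c'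
    let h : Fin R → Fin (m + 2) → X → ℝ := fun r s z =>
      (if (s : ℕ) = 0 then a r z else if (s : ℕ) = 1 then b r z else 1)
        * d (if (s : ℕ) = 0 then c' r else c r) z
    have e1 : ∀ S : Fin R → Fin (m + 2) → X,
        (∏ r, a r (S r 0) * b r (S r 1)) * sampleWeight d c c' S x
        = (∏ r, ∏ s, h r s (S r s)) * d (c' 0) x := by
      intro S
      rw [sampleWeight, ← mul_assoc, ← prod_mul_distrib]
      congr 1
      refine prod_congr rfl fun r _ => ?_
      simp only [h, prod_mul_distrib]
      congr 1
      rw [Fin.prod_univ_succ, Fin.prod_univ_succ]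
      simp
    have e2 : ∀ r, ∏ s, ∑ z, h r s z
        = (∑ z, a r z * d (c' r) z) * ∑ z, b r z * d (c r) z := by
      intro r
      rw [Fin.prod_univ_succ, Fin.prod_univ_succ]
      simp [h, hd]
    rw [sum_congr rfl fun S _ => e1 S, ← sum_mul, sum_sample_prod, prod_congr rfl fun r _ => e2 r,
      prod_mul_distrib]
    ring
  simp only [h1, ← mul_sum, ← sum_mul]
  rw [sum_prod_mul_zero (fun r c => ∑ z, a r z * d c z) fun c => d c x,
    sum_pi_prod fun r c => ∑ z, b r z * d c z]

theorem sum_sampleWeight (d : Z → X → ℝ) (hd : ∀ c, ∑ z, d c z = 1) :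
    ∑ x, ∑ c : Fin R → Z, ∑ c' : Fin R → Z, ∑ S : Fin R → Fin (m + 2) → X, sampleWeight d c c' S x
      = (Fintype.card Z : ℝ) ^ (2 * R) := by
  have h := fun x => sum_mul_sampleWeight (R := R) (m := m) d hd (fun _ _ => 1) (fun _ _ => 1) x
  simp only [one_mul, mul_one, prod_const_one, hd, sum_const, card_univ, Fintype.card_fin,
    prod_const, card_compl, card_singleton, nsmul_eq_mul] at h
  rw [sum_congr rfl fun x _ => h x, ← mul_sum, ← sum_mul, sum_comm]
  simp only [hd, sum_const, card_univ, nsmul_eq_mul, mul_one]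
  rw [mul_pow_sub_one (NeZero.ne R), ← pow_add, two_mul]

open Classical in
/-- The categories are exchangeable as far as the familiar points are concerned. -/
theorem sum_familiarWins_eq (d : Z → X → ℝ) (K : X → X → ℝ) (x : X) (r₀ : Fin R) :
    ∑ c : Fin R → Z, ∑ c' : Fin R → Z, ∑ S : Fin R → Fin (m + 2) → X,
        (if FamiliarWins K x S r₀ then sampleWeight d c c' S x else 0)
      = ∑ c : Fin R → Z, ∑ c' : Fin R → Z, ∑ S : Fin R → Fin (m + 2) → X,
        (if FamiliarWins K x S 0 then sampleWeight d c c' S x else 0) := by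
  -- Swap the familiar concepts and points of categories `0` and `r₀`, leaving the unfamiliar ones
  -- in place.
  let τ : Equiv.Perm (Fin R) := Equiv.swap 0 r₀
  have hττ : ∀ r, τ (τ r) = r := fun r => Equiv.swap_apply_self _ _ _
  let t : (Fin R → Fin (m + 2) → X) → (Fin R → Fin (m + 2) → X) :=
    fun S r s => if s = 0 then S r 0 else S (τ r) s
  have ht : Function.Involutive t := by
    intro S
    funext r s
    by_cases hs : s = 0 <;> simp [t, hs, hττ]
  let T := Function.Involutive.toPerm t ht
  rw [← Equiv.sum_comp (Equiv.arrowCongr τ (Equiv.refl Z))]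
  refine sum_congr rfl fun c _ => sum_congr rfl fun c' _ => ?_
  rw [← Equiv.sum_comp T]
  refine sum_congr rfl fun S _ => ?_
  have h1 : FamiliarWins K x (T S) r₀ ↔ FamiliarWins K x S 0 := by
    have hr₀ : τ r₀ = 0 := Equiv.swap_apply_right _ _
    simp only [FamiliarWins, T, Function.Involutive.coe_toPerm, t]
    refine exists_congr fun s => and_congr_right fun hs => ?_
    rw [if_neg hs, hr₀]
    constructor
    · intro h r hr s' hs'
      have := h (τ r) (fun h' => hr (by rw [← hττ r, h', hr₀])) s' hs'
      rwa [if_neg hs', hττ] at this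
    · intro h r hr s' hs'
      rw [if_neg hs']
      exact h (τ r) (fun h' => hr (by rw [← hr₀] at h'; exact τ.injective h')) s' hs'
  have h2 : sampleWeight d (Equiv.arrowCongr τ (Equiv.refl Z) c) c' (T S) x
      = sampleWeight d c c' S x := by
    simp only [sampleWeight, T, Function.Involutive.coe_toPerm, t]
    congr 1
    simp only [Fin.prod_univ_succ (n := m + 1), Fin.val_zero, if_true, Fin.val_succ,
      Nat.succ_ne_zero, if_false, Fin.succ_ne_zero, prod_mul_distrib]
    congr 1
    rw [← Equiv.prod_comp τ]
    simp only [hττ]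
    refine prod_congr rfl fun r _ => ?_
    simp [Equiv.arrowCongr, Function.comp, Equiv.symm_apply_apply]
  rw [h2]
  simp only [h1]

open Classical in
/-- The familiar points of category `0` win with probability at most `1 / R`, since at most one
category can win. -/
theorem sum_familiarWins_le (d : Z → X → ℝ) (hd0 : ∀ c z, 0 ≤ d c z) (K : X → X → ℝ) (x : X) :
    R * ∑ c : Fin R → Z, ∑ c' : Fin R → Z, ∑ S : Fin R → Fin (m + 2) → X,
        (if FamiliarWins K x S 0 then sampleWeight d c c' S x else 0)
      ≤ ∑ c : Fin R → Z, ∑ c' : Fin R → Z, ∑ S : Fin R → Fin (m + 2) → X,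
        sampleWeight d c c' S x := by
  have h1 := sum_congr (rfl : (univ : Finset (Fin R)) = univ) fun r _ =>
    sum_familiarWins_eq (m := m) d K x r
  rw [sum_const, card_univ, Fintype.card_fin, nsmul_eq_mul] at h1
  rw [← h1, sum_comm_three]
  refine sum_le_sum fun c _ => sum_le_sum fun c' _ => sum_le_sum fun S _ => ?_
  rw [← sum_filter, sum_const, nsmul_eq_mul]
  have hw := sampleWeight_nonneg hd0 c c' S x
  have hc : #{r | FamiliarWins K x S r} ≤ 1 := by
    rw [card_le_one]
    intro r hr r' hr'
    simp only [mem_filter, mem_univ, true_and] at hr hr'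
    by_contra hne
    obtain ⟨s, hs, h⟩ := hr
    obtain ⟨s', hs', h'⟩ := hr'
    exact lt_asymm (h r' (Ne.symm hne) s' hs') (h' r hne s hs)
  have hc' : (#{r | FamiliarWins K x S r} : ℝ) ≤ 1 := by exact_mod_cast hc
  nlinarith

open Classical in
/-- When concepts and points are averaged over, the `2 * R - 1` competitors of the unfamiliar point
`y = S 0 0` are independent and uniform, so that each is beaten with probability proportional to the
rank of `y`. -/
theorem sum_unfamiliarWins (d : Z → X → ℝ) (hd : ∀ c, ∑ z, d c z = 1) (M : ℝ)
    (hM : ∀ z, ∑ c, d c z = 1 / M) (K : X → X → ℝ) (x : X) :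
    ∑ c : Fin R → Z, ∑ c' : Fin R → Z, ∑ S : Fin R → Fin (m + 2) → X,
        (if UnfamiliarWins K x S then sampleWeight d c c' S x else 0)
      = ∑ y, (∑ c, d c x * d c y) * ((#{z | K x z < K x y} : ℝ) / M) ^ (2 * R - 1) := by
  -- For a fixed value `y` of `S 0 0`, the indicator of the event is a product over the categories.
  have h1 : ∀ (c c' : Fin R → Z) (S : Fin R → Fin (m + 2) → X),
      (if UnfamiliarWins K x S then sampleWeight d c c' S x else 0)
      = ∑ y, (∏ r, (if r = 0 then (if S r 0 = y then 1 else 0) else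
            if K x (S r 0) < K x y then (1 : ℝ) else 0) * (if K x (S r 1) < K x y then 1 else 0))
          * sampleWeight d c c' S x := by
    intro c c' S
    rw [← sum_mul, sum_eq_single (S 0 0)]
    · split_ifs with h
      · rw [prod_eq_one, one_mul]
        intro r _
        rw [if_pos (h.2 r), mul_one]
        split_ifs with h1 h2 h3
        · rfl
        · exact absurd (by rw [h1]) h2
        · rfl
        · exact absurd (h.1 r h1) h3
      · rw [UnfamiliarWins, not_and_or] at h
        push Not at h
        rcases h with ⟨r, hr, h⟩ | ⟨r, h⟩
        · rw [prod_eq_zero (mem_univ r), zero_mul]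
          rw [if_neg hr, if_neg (not_lt.2 h), zero_mul]
        · rw [prod_eq_zero (mem_univ r), zero_mul]
          rw [if_neg (not_lt.2 h), mul_zero]
    · intro y _ hy
      refine prod_eq_zero (mem_univ 0) ?_
      rw [if_pos rfl, if_neg (Ne.symm hy), zero_mul]
    · simp
  simp only [h1]
  have h2 : ∀ y, ∑ c : Z, ∑ z, (if K x z < K x y then (1 : ℝ) else 0) * d c z
      = (#{z | K x z < K x y} : ℝ) / M := by
    intro y
    rw [sum_comm]
    simp only [← mul_sum, hM]
    rw [← sum_mul, sum_boole, mul_one_div]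
  have h3 := fun y => sum_mul_sampleWeight (R := R) (m := m) d hd
    (fun r z => if r = 0 then (if z = y then 1 else 0) else if K x z < K x y then (1 : ℝ) else 0)
    (fun r z => if K x z < K x y then (1 : ℝ) else 0) x
  calc _ = ∑ y, ∑ c : Fin R → Z, ∑ c' : Fin R → Z, ∑ S : Fin R → Fin (m + 2) → X,
        (∏ r, (if r = 0 then (if S r 0 = y then 1 else 0) else
            if K x (S r 0) < K x y then (1 : ℝ) else 0) * (if K x (S r 1) < K x y then 1 else 0))
          * sampleWeight d c c' S x := (sum_comm_three _).symm
    _ = _ := by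
      refine sum_congr rfl fun y _ => ?_
      rw [h3 y]
      have h4 : ∏ r ∈ {(0 : Fin R)}ᶜ, ∑ c : Z, ∑ z, (if r = 0 then (if z = y then (1 : ℝ) else 0)
            else if K x z < K x y then (1 : ℝ) else 0) * d c z
          = ((#{z | K x z < K x y} : ℝ) / M) ^ (R - 1) := by
        rw [← h2, prod_congr rfl (g := fun _ => ∑ c : Z, ∑ z,
          (if K x z < K x y then (1 : ℝ) else 0) * d c z), prod_const]
        · simp [card_compl]
        · intro r hr
          have : r ≠ 0 := by simpa using hr
          simp only [if_neg this]
      rw [h4]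
      simp only [h2]
      simp only [if_true, prod_const, card_univ, Fintype.card_fin, ite_mul, one_mul, zero_mul,
        sum_ite_eq', mem_univ]
      have hR := NeZero.pos R
      rw [show 2 * R - 1 = R + (R - 1) by omega, pow_add]
      rw [sum_congr rfl fun c _ => mul_comm (d c y) (d c x)]
      ring
end

/-! ### The concept model -/

section

variable {nw nc L : ℕ}

theorem card_conceptsOf_eq (φ : Equipartition nw nc) (c : ConceptSeq nc L) :
    #{y : Sentence nw L | conceptsOf φ.1 y = c} = (nw / nc) ^ L := by
  have h : ({y : Sentence nw L | conceptsOf φ.1 y = c} : Finset _)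
      = Fintype.piFinset fun i => ({w | φ.1 w = c i} : Finset (Fin nw)) := by
    ext y
    simp [conceptsOf, funext_iff]
  rw [h, Fintype.card_piFinset]
  simp [φ.2]

theorem sentenceDensity_eq (φ : Equipartition nw nc) (c : ConceptSeq nc L) (x : Sentence nw L) :
    sentenceDensity φ.1 c x
      = if conceptsOf φ.1 x = c then 1 / (((nw / nc : ℕ) : ℝ) ^ L) else 0 := by
  rw [sentenceDensity, card_conceptsOf_eq, Nat.cast_pow]

theorem sentenceDensity_nonneg (φ : Equipartition nw nc) (c : ConceptSeq nc L)
    (x : Sentence nw L) : 0 ≤ sentenceDensity φ.1 c x := by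
  rw [sentenceDensity_eq]; positivity

theorem sum_sentenceDensity (hq : 0 < nw / nc) (φ : Equipartition nw nc) (c : ConceptSeq nc L) :
    ∑ x, sentenceDensity φ.1 c x = 1 := by
  have hq' : (0 : ℝ) < ((nw / nc : ℕ) : ℝ) := by exact_mod_cast hq
  simp only [sentenceDensity_eq]
  rw [← sum_filter, sum_const, card_conceptsOf_eq, nsmul_eq_mul, Nat.cast_pow]
  field_simp

theorem sum_concepts_sentenceDensity (φ : Equipartition nw nc) (x : Sentence nw L) :
    ∑ c, sentenceDensity φ.1 c x = 1 / (((nw / nc : ℕ) : ℝ) ^ L) := by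
  simp [sentenceDensity_eq]

theorem sum_concepts_sentenceDensity_mul (φ : Equipartition nw nc) (x y : Sentence nw L) :
    ∑ c, sentenceDensity φ.1 c x * sentenceDensity φ.1 c y
      = if conceptsOf φ.1 x = conceptsOf φ.1 y then 1 / (((nw / nc : ℕ) : ℝ) ^ L) ^ 2 else 0 := by
  simp only [sentenceDensity_eq, ite_mul, zero_mul, sum_ite_eq, mem_univ, if_true]
  rw [mul_ite, mul_zero, one_div_mul_one_div, ← sq]
  simp only [eq_comm]

theorem jointDensity_eq {R m : ℕ} [NeZero R] (T : Task nw nc L R)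
    (S : TrainSample nw L R (m + 2)) (x : Sentence nw L) :
    jointDensity T S x = 1 / (Fintype.card (Task nw nc L R) : ℝ)
      * sampleWeight (sentenceDensity T.1.1) T.2.1 T.2.2 S x := by
  rw [jointDensity, mul_assoc]
  rfl

theorem card_equipartition_mul (hdvd : nc ∣ nw) :
    Fintype.card (Equipartition nw nc) * (nw / nc).factorial ^ nc = nw.factorial := by
  have h := card_fiber_functions (B := Fin nw) (C := Fin nc) (fun _ => nw / nc)
    (by simp [Nat.mul_div_cancel' hdvd])
  rw [prod_const, card_univ, Fintype.card_fin, Fintype.card_fin] at h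
  rw [Fintype.card_subtype]
  convert h

theorem card_equipartition_filter (P : (Fin nw → Fin nc) → Prop) [DecidablePred P] :
    #{φ : Equipartition nw nc | P φ.1}
      = #{φ : Fin nw → Fin nc | (∀ c, #{w | φ w = c} = nw / nc) ∧ P φ} := by
  refine card_bij (fun φ _ => φ.1) ?_ ?_ ?_
  · intro φ hφ
    simp only [mem_filter, mem_univ, true_and] at hφ ⊢
    exact ⟨φ.2, hφ⟩
  · exact fun φ _ φ' _ h => Subtype.ext h
  · intro φ hφ
    simp only [mem_filter, mem_univ, true_and] at hφ
    exact ⟨⟨φ, hφ.1⟩, by simpa using hφ.2, rfl⟩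

/-- Joint distribution of the test sentence and the unfamiliar training sentence of its category,
averaged over the equipartition. -/
noncomputable def pairMass (nc : ℕ) (x y : Sentence nw L) : ℝ :=
  (nc : ℝ) ^ L / ((nw : ℝ) ^ L) ^ 2
    * ((#{φ : Equipartition nw nc | conceptsOf φ.1 x = conceptsOf φ.1 y} : ℝ)
      / Fintype.card (Equipartition nw nc))

theorem pairMass_nonneg (x y : Sentence nw L) : 0 ≤ pairMass nc x y := by
  unfold pairMass; positivity

theorem sum_pairMass (hnw : 1 ≤ nw) (hdvd : nc ∣ nw) :
    ∑ x : Sentence nw L, ∑ y : Sentence nw L, pairMass nc x y = 1 := by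
  have hΦ : Fintype.card (Equipartition nw nc) ≠ 0 := by
    intro h
    have := card_equipartition_mul hdvd
    rw [h, zero_mul] at this
    exact (Nat.factorial_pos nw).ne this
  simp only [pairMass, ← mul_sum, ← sum_div]
  have h : (∑ x : Sentence nw L, ∑ y : Sentence nw L,
        (#{φ : Equipartition nw nc | conceptsOf φ.1 x = conceptsOf φ.1 y} : ℝ))
      = Fintype.card (Equipartition nw nc) * ((nw : ℝ) ^ L * ((nw / nc : ℕ) : ℝ) ^ L) := by
    simp only [card_filter, Nat.cast_sum]
    calc _ = ∑ φ : Equipartition nw nc, ∑ x : Sentence nw L, ∑ y : Sentence nw L,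
          ((if conceptsOf φ.1 x = conceptsOf φ.1 y then 1 else 0 : ℕ) : ℝ) := by
            symm
            rw [sum_comm]
            refine sum_congr rfl fun x _ => ?_
            rw [sum_comm]
      _ = ∑ φ : Equipartition nw nc, ∑ x : Sentence nw L, ((nw / nc : ℕ) : ℝ) ^ L := by
            refine sum_congr rfl fun φ _ => sum_congr rfl fun x _ => ?_
            rw [← Nat.cast_sum, ← card_filter]
            simp only [eq_comm (a := conceptsOf φ.1 x)]
            rw [card_conceptsOf_eq, Nat.cast_pow]
      _ = _ := by simp
  rw [h]
  have h1 : (nw : ℝ) = nc * ((nw / nc : ℕ) : ℝ) := by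
    rw [← Nat.cast_mul, Nat.mul_div_cancel' hdvd]
  have h2 : (nw : ℝ) ≠ 0 := by positivity
  have h3 : (Fintype.card (Equipartition nw nc) : ℝ) ≠ 0 := by exact_mod_cast hΦ
  rw [mul_div_cancel_left₀ _ h3, div_mul_eq_mul_div, div_eq_one_iff_eq (by positivity)]
  calc (nc : ℝ) ^ L * ((nw : ℝ) ^ L * ((nw / nc : ℕ) : ℝ) ^ L)
      = (nw : ℝ) ^ L * (nc * ((nw / nc : ℕ) : ℝ)) ^ L := by rw [mul_pow]; ring
    _ = _ := by rw [← h1]; ring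

/-- The proper edges of the graph on the vocabulary that joins the words of two sentences at equal
positions. -/
def pairEdges (x y : Sentence nw L) : Finset (Sym2 (Fin nw)) := properEdges fun i => (x i, y i)

/-- Two sentences have the same concepts if and only if the partition is constant along their
edges. -/
theorem conceptsOf_eq_iff {C : Type*} (φ : Fin nw → C) (x y : Sentence nw L) :
    (∀ i, φ (x i) = φ (y i)) ↔ ConstOn (pairEdges x y) φ := by
  simp only [ConstOn, pairEdges, properEdges, mem_filter, mem_image, mem_univ, true_and]
  constructor
  · rintro h u v ⟨⟨i, hi⟩, -⟩
    rcases Sym2.eq_iff.1 hi with ⟨rfl, rfl⟩ | ⟨rfl, rfl⟩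
    · exact h i
    · exact (h i).symm
  · intro h i
    by_cases hi : x i = y i
    · rw [hi]
    · exact h _ _ ⟨⟨i, rfl⟩, by simpa using hi⟩

/-- `fComb` gives the mass of every pair of sentences whose graph is a forest of type `k`. -/
theorem pairMass_of_mem (hdvd : nc ∣ nw) {k : Fin (L + 1) → ℕ} {x y : Sentence nw L}
    (h : pairEdges x y ∈ forestsOfType k (Fin nw)) :
    pairMass nc x y = fComb nw nc k / ((nw : ℝ) ^ L) ^ 2 := by
  simp only [forestsOfType, mem_image, mem_product, mem_univ, true_and, Prod.exists] at h
  obtain ⟨e, P, hP, hE⟩ := h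
  have h1 : ∀ φ : Fin nw → Fin nc, conceptsOf φ x = conceptsOf φ y ↔
      ∀ z : Cell k, φ (e.symm z) = φ (e.symm ⟨z.1, 0⟩) := by
    intro φ
    rw [← constOn_forestEdges_iff e hP, hE, ← conceptsOf_eq_iff, funext_iff]
    rfl
  have h2 : (#{φ : Equipartition nw nc | conceptsOf φ.1 x = conceptsOf φ.1 y} : ℝ)
      = ∑ A ∈ admissible nw nc k, ∏ i : Fin (L + 1),
          ((k i).factorial : ℝ) / ∏ j : Fin nc, ((A i j).factorial : ℝ) := by
    rw [← card_colorings nc (nw / nc) nw rfl e,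
      card_equipartition_filter fun φ => conceptsOf φ x = conceptsOf φ y]
    simp only [h1]
  have h3 : (Fintype.card (Equipartition nw nc) : ℝ) * ((nw / nc).factorial : ℝ) ^ nc
      = nw.factorial := by exact_mod_cast card_equipartition_mul hdvd
  have h4 : (nw.factorial : ℝ) ≠ 0 := by positivity
  have h5 : (Fintype.card (Equipartition nw nc) : ℝ) ≠ 0 := by
    intro h; rw [h, zero_mul] at h3; exact h4 h3.symm
  rw [pairMass, h2, fComb, ← h3]
  have h6 : (((nw / nc).factorial : ℝ)) ^ nc ≠ 0 := by positivity
  field_simp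

theorem fComb_nonneg (k : Fin (L + 1) → ℕ) : 0 ≤ fComb nw nc k := by
  unfold fComb; positivity

theorem card_pairs_of_type (k : Fin (L + 1) → ℕ) :
    #{q : Sentence nw L × Sentence nw L | pairEdges q.1 q.2 ∈ forestsOfType k (Fin nw)}
      = #(forestsOfType k (Fin nw)) * coverCount nw L (gam k) := by
  rw [card_eq_sum_card_fiberwise (f := fun q => pairEdges q.1 q.2) (t := forestsOfType k (Fin nw))
    fun q hq => by simpa using hq]
  refine sum_const_nat fun E hE => ?_
  have hE' := hE
  simp only [forestsOfType, mem_image, mem_product, mem_univ, true_and, Prod.exists] at hE'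
  obtain ⟨e, P, hP, rfl⟩ := hE'
  rw [← card_forestEdges e hP]
  have := card_properEdges_eq L (forestEdges e P) fun a ha => not_isDiag_of_mem_forestEdges e hP ha
  rw [Fintype.card_fin] at this
  rw [← this]
  refine card_equiv (Equiv.arrowProdEquivProdArrow _ _ _).symm fun q => ?_
  simp only [mem_filter, mem_univ, true_and]
  exact ⟨fun h => h.2, fun h => ⟨by rw [show pairEdges q.1 q.2 = _ from h]; exact hE, h⟩⟩

/-- `gComb` bounds from below the proportion of pairs of sentences whose graph is a forest of type
`k`. -/
theorem gComb_le (hnw : 1 ≤ nw) {k : Fin (L + 1) → ℕ} (hk : gamHat k = nw) :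
    gComb nw k ≤ (#{q : Sentence nw L × Sentence nw L |
      pairEdges q.1 q.2 ∈ forestsOfType k (Fin nw)} : ℝ) / ((nw : ℝ) ^ L) ^ 2 := by
  rw [card_pairs_of_type]
  have hc : ((gam k).factorial : ℝ) * ∑ a ∈ Finset.Icc (gam k) L,
      (L.choose a : ℝ) * (Nat.stirlingSecond a (gam k) : ℝ) * 2 ^ a * (nw : ℝ) ^ (L - a)
      ≤ (coverCount nw L (gam k) : ℝ) := by
    rw [coverCount]
    push_cast
    refine mul_le_mul_of_nonneg_left ?_ (by positivity)
    refine sum_le_sum_of_subset_of_nonneg (fun a ha => ?_) fun _ _ _ => by positivity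
    rw [mem_Icc] at ha
    exact mem_range.2 (by omega)
  have hf : (nw.factorial : ℝ) / (∏ i : Fin (L + 1), ((k i).factorial : ℝ)) *
      ∏ i : Fin L, (((i : ℝ) + 2) ^ (i : ℕ) / (((i : ℕ) + 2).factorial : ℝ)) ^ k i.succ
      ≤ (#(forestsOfType k (Fin nw)) : ℝ) := by
    have h := le_card_forestsOfType (V := Fin nw) (k := k) (by rw [hk, Fintype.card_fin])
    rw [Fintype.card_fin] at h
    have h' : (nw.factorial : ℝ) * ∏ i : Fin (L + 1), (((i : ℝ) + 1) ^ ((i : ℕ) - 1)) ^ k i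
      ≤ ((∏ i, ((k i).factorial : ℝ)) * ∏ i : Fin (L + 1), (((i : ℕ) + 1).factorial : ℝ) ^ k i)
        * (#(forestsOfType k (Fin nw)) : ℝ) := by exact_mod_cast h
    -- Components of size `1` contribute the factor `1 ^ (0 - 1) / 1! = 1`, the subtraction being
    -- truncated.
    have e1 : ∏ i : Fin L, (((i : ℝ) + 2) ^ (i : ℕ) / (((i : ℕ) + 2).factorial : ℝ)) ^ k i.succ
        = (∏ i : Fin (L + 1), (((i : ℝ) + 1) ^ ((i : ℕ) - 1)) ^ k i)
          / ∏ i : Fin (L + 1), (((i : ℕ) + 1).factorial : ℝ) ^ k i := by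
      rw [← prod_div_distrib, Fin.prod_univ_succ]
      simp only [Fin.val_zero, Fin.val_succ, ← div_pow]
      norm_num [add_assoc]
    have p1 : (0 : ℝ) < ∏ i, ((k i).factorial : ℝ) := prod_pos fun _ _ => by positivity
    have p2 : (0 : ℝ) < ∏ i : Fin (L + 1), (((i : ℕ) + 1).factorial : ℝ) ^ k i :=
      prod_pos fun _ _ => by positivity
    rw [e1, div_mul_div_comm, div_le_iff₀ (mul_pos p1 p2)]
    linarith
  have hN : (0 : ℝ) < (nw : ℝ) ^ (2 * L) := by positivity
  rw [gComb, ← pow_mul, mul_comm L 2, le_div_iff₀ hN]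
  push_cast
  calc _ = ((nw.factorial : ℝ) / (∏ i : Fin (L + 1), ((k i).factorial : ℝ)) *
      ∏ i : Fin L, (((i : ℝ) + 2) ^ (i : ℕ) / (((i : ℕ) + 2).factorial : ℝ)) ^ k i.succ)
      * (((gam k).factorial : ℝ) * ∑ a ∈ Finset.Icc (gam k) L,
      (L.choose a : ℝ) * (Nat.stirlingSecond a (gam k) : ℝ) * 2 ^ a * (nw : ℝ) ^ (L - a)) := by
        field_simp
    _ ≤ _ := mul_le_mul hf hc (by positivity) (by positivity)

theorem le_maxOverFinset {α : Type*} {s : Finset α} (f : α → ℝ) {a : α} (ha : a ∈ s) :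
    f a ≤ maxOverFinset s f := by
  rw [maxOverFinset, dif_pos ⟨a, ha⟩]
  exact le_sup' f ha

theorem maxOverFinset_nonneg {α : Type*} (s : Finset α) {f : α → ℝ} (hf : ∀ a, 0 ≤ f a) :
    0 ≤ maxOverFinset s f := by
  by_cases h : s.Nonempty
  · exact (hf _).trans (le_maxOverFinset f h.choose_spec)
  · rw [maxOverFinset, dif_neg h]

theorem forestsOfType_disjoint {k k' : Fin (L + 1) → ℕ} {E : Finset (Sym2 (Fin nw))}
    (h : E ∈ forestsOfType k (Fin nw)) (h' : E ∈ forestsOfType k' (Fin nw)) : k = k' := by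
  simp only [forestsOfType, mem_image, mem_product, mem_univ, true_and, Prod.exists] at h h'
  obtain ⟨e, P, hP, rfl⟩ := h
  obtain ⟨e', P', hP', hE⟩ := h'
  exact type_eq_of_forestEdges_eq hP hP' hE.symm

/-- The proportion of sentences that are strictly less similar to `x` than `y` is. -/
noncomputable def rankFrac (K : Sentence nw L → Sentence nw L → ℝ) (x y : Sentence nw L) : ℝ :=
  (#{z | K x z < K x y} : ℝ) / (nw : ℝ) ^ L

theorem rankFrac_nonneg (K : Sentence nw L → Sentence nw L → ℝ) (x y : Sentence nw L) :
    0 ≤ rankFrac K x y := by unfold rankFrac; positivity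

theorem rankFrac_le_one (K : Sentence nw L → Sentence nw L → ℝ) (x y : Sentence nw L) :
    rankFrac K x y ≤ 1 := by
  refine div_le_one_of_le₀ ?_ (by positivity)
  have : #{z | K x z < K x y} ≤ Fintype.card (Sentence nw L) := card_le_univ _
  rw [Fintype.card_fun, Fintype.card_fin, Fintype.card_fin] at this
  exact_mod_cast this

theorem sum_rankFrac_pow_le (hnw : 1 ≤ nw) (K : Sentence nw L → Sentence nw L → ℝ) (t : ℕ) :
    ∑ x, ∑ y, rankFrac K x y ^ t ≤ ((nw : ℝ) ^ L) ^ 2 / (t + 1) := by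
  have hN : (0 : ℝ) < (nw : ℝ) ^ L := by positivity
  have h1 : ∀ x, ∑ y, rankFrac K x y ^ t ≤ (nw : ℝ) ^ L / (t + 1) := by
    intro x
    have h := mul_sum_card_lt_pow_le (K x) t univ
    rw [card_univ, Fintype.card_fun, Fintype.card_fin, Fintype.card_fin] at h
    have h' : ((t : ℝ) + 1) * ∑ y, (#{z | K x z < K x y} : ℝ) ^ t ≤ ((nw : ℝ) ^ L) ^ (t + 1) := by
      exact_mod_cast h
    simp only [rankFrac, div_pow]
    rw [← sum_div, div_le_div_iff₀ (by positivity) (by positivity), ← pow_succ']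
    linarith
  refine (sum_le_sum fun x _ => h1 x).trans (le_of_eq ?_)
  rw [sum_const, card_univ, Fintype.card_fun, Fintype.card_fin, Fintype.card_fin, nsmul_eq_mul]
  push_cast
  ring

/-- The probability that `y` beats `t` independent uniform sentences. Outside the pairs of forest
type in `levelIndex nw L l` the rank is bounded by `1`, on them the mass is bounded by its
maximum. -/
theorem sum_pairMass_mul_rank_le (hnw : 1 ≤ nw) (hdvd : nc ∣ nw) (l t : ℕ)
    (K : Sentence nw L → Sentence nw L → ℝ) :
    ∑ x, ∑ y, pairMass nc x y * rankFrac K x y ^ t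
      ≤ 1 - ∑ k ∈ levelIndex nw L l, fComb nw nc k * gComb nw k
        + maxOverFinset (levelIndex nw L l) (fun k => fComb nw nc k) / (t + 1) := by
  set F := maxOverFinset (levelIndex nw L l) (fun k => fComb nw nc k) with hF
  have hF0 : 0 ≤ F := maxOverFinset_nonneg _ fun k => fComb_nonneg k
  have hN : (0 : ℝ) < (nw : ℝ) ^ L := by positivity
  have hpt : ∀ x y : Sentence nw L, pairMass nc x y * rankFrac K x y ^ t
      ≤ pairMass nc x y
        - ∑ k ∈ levelIndex nw L l, (if pairEdges x y ∈ forestsOfType k (Fin nw) then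
            fComb nw nc k / ((nw : ℝ) ^ L) ^ 2 else 0)
        + F / ((nw : ℝ) ^ L) ^ 2 * rankFrac K x y ^ t := by
    intro x y
    have hr0 : 0 ≤ rankFrac K x y ^ t := pow_nonneg (rankFrac_nonneg K x y) t
    have hr1 : rankFrac K x y ^ t ≤ 1 := pow_le_one₀ (rankFrac_nonneg K x y) (rankFrac_le_one K x y)
    have hp := pairMass_nonneg (nc := nc) x y
    by_cases hex : ∃ k ∈ levelIndex nw L l, pairEdges x y ∈ forestsOfType k (Fin nw)
    · obtain ⟨k, hk, hm⟩ := hex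
      rw [sum_eq_single_of_mem k hk fun k' _ hne => if_neg fun h' =>
        hne (forestsOfType_disjoint h' hm), if_pos hm, pairMass_of_mem hdvd hm, sub_self, zero_add]
      gcongr
      exact le_maxOverFinset (fun k => fComb nw nc k) hk
    · rw [sum_eq_zero fun k hk => if_neg fun h => hex ⟨k, hk, h⟩, sub_zero]
      have : 0 ≤ F / ((nw : ℝ) ^ L) ^ 2 * rankFrac K x y ^ t := by positivity
      nlinarith
  refine (sum_le_sum fun x _ => sum_le_sum fun y _ => hpt x y).trans ?_
  simp only [sum_add_distrib, sum_sub_distrib, ← mul_sum]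
  rw [sum_pairMass hnw hdvd]
  have h1 : ∑ k ∈ levelIndex nw L l, fComb nw nc k * gComb nw k
      ≤ ∑ x : Sentence nw L, ∑ y : Sentence nw L, ∑ k ∈ levelIndex nw L l,
        (if pairEdges x y ∈ forestsOfType k (Fin nw) then
            fComb nw nc k / ((nw : ℝ) ^ L) ^ 2 else 0) := by
    rw [← Fintype.sum_prod_type', sum_comm]
    refine sum_le_sum fun k hk => ?_
    rw [← sum_filter, sum_const, nsmul_eq_mul]
    have h := mul_le_mul_of_nonneg_left (gComb_le hnw ((mem_levelIndex k).1 hk).1)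
      (fComb_nonneg (nw := nw) (nc := nc) k)
    refine h.trans (le_of_eq ?_)
    ring
  have h2 : F / ((nw : ℝ) ^ L) ^ 2 * ∑ x, ∑ y, rankFrac K x y ^ t ≤ F / (t + 1) := by
    calc _ ≤ F / ((nw : ℝ) ^ L) ^ 2 * (((nw : ℝ) ^ L) ^ 2 / (t + 1)) := by
          gcongr
          exact sum_rankFrac_pow_le hnw K t
      _ = _ := by field_simp
  linarith

open Classical in
/-- Bound for the probability of success under a fixed equipartition, multiplied by the number of
choices of the concepts. -/
theorem sum_success_le {R m : ℕ} [NeZero R] (hnw : 1 ≤ nw) (hdvd : nc ∣ nw)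
    {F : Type*} [NormedAddCommGroup F] [InnerProductSpace ℝ F] (ψ : Sentence nw L → F)
    (φ : Equipartition nw nc) :
    ∑ c : Fin R → ConceptSeq nc L, ∑ c' : Fin R → ConceptSeq nc L,
        ∑ S : TrainSample nw L R (m + 2), ∑ x : Sentence nw L,
        (if NNSuccess ψ S x then sampleWeight (sentenceDensity φ.1) c c' S x else 0)
      ≤ ((nc : ℝ) ^ L) ^ (2 * R) * (1 / R + ∑ x, ∑ y,
        (if conceptsOf φ.1 x = conceptsOf φ.1 y then (nc : ℝ) ^ L / ((nw : ℝ) ^ L) ^ 2 else 0)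
          * rankFrac (fun x z => inner ℝ (ψ x) (ψ z)) x y ^ (2 * R - 1)) := by
  set K : Sentence nw L → Sentence nw L → ℝ := fun x z => inner ℝ (ψ x) (ψ z) with hK
  have hncq : nw = nc * (nw / nc) := (Nat.mul_div_cancel' hdvd).symm
  have hq : 0 < nw / nc := Nat.pos_of_ne_zero fun h => by rw [h, mul_zero] at hncq; omega
  have hnc : 0 < nc := Nat.pos_of_ne_zero fun h => by rw [h, zero_mul] at hncq; omega
  set d := sentenceDensity (L := L) φ.1 with hd
  have hd0 : ∀ c z, 0 ≤ d c z := sentenceDensity_nonneg φ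
  have hd1 : ∀ c, ∑ z, d c z = 1 := sum_sentenceDensity hq φ
  have hR : (0 : ℝ) < R := by exact_mod_cast NeZero.pos R
  -- Success is contained in the union of the two events.
  have hle : ∀ (c c' : Fin R → ConceptSeq nc L) (S : TrainSample nw L R (m + 2))
      (x : Sentence nw L),
      (if NNSuccess ψ S x then sampleWeight d c c' S x else 0)
      ≤ (if FamiliarWins K x S 0 then sampleWeight d c c' S x else 0)
        + if UnfamiliarWins K x S then sampleWeight d c c' S x else 0 := by
    intro c c' S x
    have hw := sampleWeight_nonneg hd0 c c' S x
    by_cases h : NNSuccess ψ S x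
    · rw [if_pos h]
      rcases familiarWins_or_unfamiliarWins (K := K) h with h | h
      · rw [if_pos h]; split_ifs <;> linarith
      · rw [if_pos h]; split_ifs <;> linarith
    · rw [if_neg h]; split_ifs <;> linarith
  have hA : ∑ x, ∑ c : Fin R → ConceptSeq nc L, ∑ c' : Fin R → ConceptSeq nc L,
        ∑ S : TrainSample nw L R (m + 2),
        (if FamiliarWins K x S 0 then sampleWeight d c c' S x else 0)
      ≤ ((nc : ℝ) ^ L) ^ (2 * R) * (1 / R) := by
    rw [mul_one_div, le_div_iff₀ hR, mul_comm, mul_sum]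
    refine (sum_le_sum fun x _ => sum_familiarWins_le d hd0 K x).trans (le_of_eq ?_)
    rw [sum_sampleWeight d hd1]
    simp
  have hB : ∑ x, ∑ c : Fin R → ConceptSeq nc L, ∑ c' : Fin R → ConceptSeq nc L,
        ∑ S : TrainSample nw L R (m + 2),
        (if UnfamiliarWins K x S then sampleWeight d c c' S x else 0)
      = ((nc : ℝ) ^ L) ^ (2 * R) * ∑ x, ∑ y,
        (if conceptsOf φ.1 x = conceptsOf φ.1 y then (nc : ℝ) ^ L / ((nw : ℝ) ^ L) ^ 2 else 0)
          * rankFrac K x y ^ (2 * R - 1) := by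
    rw [mul_sum]
    refine sum_congr rfl fun x _ => ?_
    rw [sum_unfamiliarWins d hd1 _ (sum_concepts_sentenceDensity φ), mul_sum]
    refine sum_congr rfl fun y _ => ?_
    rw [hd, sum_concepts_sentenceDensity_mul]
    split_ifs with h
    · obtain ⟨p, hp⟩ : ∃ p, 2 * R = p + 1 := ⟨2 * R - 1, by have := NeZero.pos R; omega⟩
      have h1 : (nw : ℝ) = nc * ((nw / nc : ℕ) : ℝ) := by exact_mod_cast hncq
      have h2 : (0 : ℝ) < nc := by exact_mod_cast hnc
      have h3 : (0 : ℝ) < ((nw / nc : ℕ) : ℝ) := by exact_mod_cast hq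
      have h4 : (0 : ℝ) < (nc : ℝ) ^ L := by positivity
      have h5 : (0 : ℝ) < ((nw / nc : ℕ) : ℝ) ^ L := by positivity
      rw [rankFrac, hp, Nat.add_sub_cancel, div_pow, div_pow, h1, mul_pow, mul_pow, mul_pow]
      generalize (nc : ℝ) ^ L = a at h4 ⊢
      generalize ((nw / nc : ℕ) : ℝ) ^ L = b at h5 ⊢
      generalize (#{z | K x z < K x y} : ℝ) ^ p = r
      rw [pow_succ]
      field_simp
      ring
    · simp
  rw [mul_add, ← hB, ← sum_comm_three]
  refine (sum_le_sum fun x _ => sum_le_sum fun c _ =>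
    sum_le_sum fun c' _ => sum_le_sum fun S _ => hle c c' S x).trans ?_
  simp only [sum_add_distrib]
  exact add_le_add hA le_rfl

theorem one_sub_avgError_le {R m : ℕ} [NeZero R] (hnw : 1 ≤ nw) (hdvd : nc ∣ nw)
    {F : Type*} [NormedAddCommGroup F] [InnerProductSpace ℝ F] (ψ : Sentence nw L → F) :
    1 - avgError nc R (m + 2) ψ ≤ 1 / R + ∑ x, ∑ y, pairMass nc x y
      * rankFrac (fun x z => inner ℝ (ψ x) (ψ z)) x y ^ (2 * R - 1) := by
  classical
  have hΦ : Fintype.card (Equipartition nw nc) ≠ 0 := by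
    intro h
    have := card_equipartition_mul hdvd
    rw [h, zero_mul] at this
    exact (Nat.factorial_pos nw).ne this
  have hnc : nc ≠ 0 := by rintro rfl; rw [Nat.zero_dvd] at hdvd; omega
  set K : Sentence nw L → Sentence nw L → ℝ := fun x z => inner ℝ (ψ x) (ψ z) with hK
  have h1 : 1 - avgError nc R (m + 2) ψ = 1 / (Fintype.card (Task nw nc L R) : ℝ) *
      ∑ φ : Equipartition nw nc, ∑ c : Fin R → ConceptSeq nc L, ∑ c' : Fin R → ConceptSeq nc L,
        ∑ S : TrainSample nw L R (m + 2), ∑ x : Sentence nw L,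
        (if NNSuccess ψ S x then sampleWeight (sentenceDensity φ.1) c c' S x else 0) := by
    rw [avgError, sub_sub_cancel, Fintype.sum_prod_type, mul_sum]
    refine sum_congr rfl fun φ _ => ?_
    rw [Fintype.sum_prod_type, mul_sum]
    refine sum_congr rfl fun c _ => ?_
    rw [mul_sum]
    refine sum_congr rfl fun c' _ => ?_
    rw [mul_sum]
    refine sum_congr rfl fun S _ => ?_
    rw [mul_sum]
    refine sum_congr rfl fun x _ => ?_
    rw [jointDensity_eq, mul_ite, mul_zero]
  have h2 : (Fintype.card (Task nw nc L R) : ℝ)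
      = Fintype.card (Equipartition nw nc) * ((nc : ℝ) ^ L) ^ (2 * R) := by
    simp only [Fintype.card_prod, Fintype.card_fun, Fintype.card_fin]
    push_cast
    rw [two_mul, pow_add]
  have h3 : (0 : ℝ) < Fintype.card (Equipartition nw nc) := by
    exact_mod_cast Nat.pos_of_ne_zero hΦ
  have h4 : (0 : ℝ) < ((nc : ℝ) ^ L) ^ (2 * R) := by positivity
  rw [h1, h2, one_div_mul_eq_div, div_le_iff₀ (mul_pos h3 h4)]
  refine (sum_le_sum fun φ _ => sum_success_le hnw hdvd ψ φ).trans (le_of_eq ?_)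
  rw [← mul_sum, sum_add_distrib, sum_const, card_univ, nsmul_eq_mul]
  have h5 : ∑ φ : Equipartition nw nc, ∑ x, ∑ y,
        (if conceptsOf φ.1 x = conceptsOf φ.1 y then (nc : ℝ) ^ L / ((nw : ℝ) ^ L) ^ 2 else 0)
          * rankFrac K x y ^ (2 * R - 1)
      = Fintype.card (Equipartition nw nc)
        * ∑ x, ∑ y, pairMass nc x y * rankFrac K x y ^ (2 * R - 1) := by
    rw [sum_comm, mul_sum]
    refine sum_congr rfl fun x _ => ?_
    rw [sum_comm, mul_sum]
    refine sum_congr rfl fun y _ => ?_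
    rw [← sum_mul, ← sum_filter, sum_const, nsmul_eq_mul, pairMass]
    field_simp
  rw [h5]
  ring
end

end ConceptModel

open ConceptModel
theorem theorem3 (nw nc L R nspl : ℕ) [NeZero R] (hnw : 1 ≤ nw) (hdvd : nc ∣ nw)
    (hnspl : 2 ≤ nspl)
    {F : Type*} [NormedAddCommGroup F] [InnerProductSpace ℝ F] [CompleteSpace F]
    (ψ : Sentence nw L → F) (l : ℕ) (hl : l ≤ L) :
    (∑ k ∈ levelIndex nw L l, fComb nw nc k * gComb nw k) -
        1 / (R : ℝ) * (1 + 1 / 2 * maxOverFinset (levelIndex nw L l) (fun k => fComb nw nc k)) ≤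
      avgError nc R nspl ψ := by
  obtain ⟨m, rfl⟩ := Nat.exists_eq_add_of_le' hnspl
  have h1 := one_sub_avgError_le (R := R) (m := m) hnw hdvd ψ
  have h2 := sum_pairMass_mul_rank_le hnw hdvd l (2 * R - 1)
    (fun x z : Sentence nw L => inner ℝ (ψ x) (ψ z))
  have hR : (0 : ℝ) < R := by exact_mod_cast NeZero.pos R
  have h3 : ((2 * R - 1 : ℕ) : ℝ) + 1 = 2 * R := by
    have := NeZero.pos R
    exact_mod_cast Nat.sub_add_cancel (by omega : 1 ≤ 2 * R)
  rw [h3] at h2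
  have h4 : ∀ M : ℝ, M / (2 * R) = 1 / R * (1 / 2 * M) := fun M => by field_simp
  rw [h4] at h2
  rw [mul_add]
  linarith
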